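/- Let $E$ be a finite dimensional Euclidean space, $N\ge 2$, and $m_1,\dots,m_N>0$. For a configuration $x=(r_1,\dots,r_N)\in E^N$ let $U(x)=\sum_{i<j} m_im_j\,\|r_i-r_j\|^{-1}\in(0,+\infty]$ and $I(x)=\sum_i m_i\|r_i\|^2$, and let $\Omega=\{x\in E^N : U(x)<+\infty\}$ be the set of configurations without collisions. The action of an absolutely continuous curve $\gamma=(\gamma_1,\dots,\gamma_N):[a,b]\to E^N$ is $$A(\gamma)=\int_a^b\Big(\tfrac12\sum_i m_i\|\dot\gamma_i(t)\|^2+U(\gamma(t))\Big)\,dt\in(0,+\infty],$$ and $\phi(x,y)$ is the infimum of $A(\gamma)$ over all absolutely continuous curves $\gamma:[a,b]\to E^N$, with $a<b$ arbitrary, such that $\gamma(a)=x$ and $\gamma(b)=y$. A free time minimizer on an interval $J\subset\mathbb R$ is a curve $\gamma:J\to E^N$ which, on every compact subinterval $[a,b]\subset J$ with $a<b$, is absolutely continuous and satisfies $A(\gamma|_{[a,b]})=\phi(\gamma(a),\gamma(b))$. Let $t_0\in\mathbb R$, let $x:[t_0,+\infty)\to\Omega$ be a free time minimizer, and write $I(t)=I(x(t))$.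 Then $I$ is positive and differentiable on $[t_0,+\infty)$ (one-sidedly at $t_0$), and the function $g:[t_0,+\infty)\to\mathbb R$, $$g(t)=\dot I(t)\,I(t)^{-1/4},$$ is nondecreasing and bounded. Moreover, for every $t_1\ge t_0$ with $t_1>0$ there is a constant $\beta>0$ such that $I(t)\le\beta\,t^{4/3}$ for all $t\ge t_1$. (In particular, if $t_0>0$ the bound holds on all of $[t_0,+\infty)$.) -/

import Mathlib

open scoped ENNReal
open MeasureTheory Set

noncomputable section

namespace NBody

variable {E : Type*} [NormedAddCommGroup E] [InnerProductSpace ℝ E] {N : ℕ}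

/-- The Newtonian potential `U(x) = ∑_{i<j} m_i m_j / ‖r_i - r_j‖`, with values in `[0, ∞]`
(for positive masses a collision `r_i = r_j` gives `U(x) = ∞`). -/
def potential (m : Fin N → ℝ) (x : Fin N → E) : ℝ≥0∞ :=
  ∑ i, ∑ j ∈ Finset.Ioi i, ENNReal.ofReal (m i * m j) / ENNReal.ofReal ‖x i - x j‖

/-- The kinetic energy `T(v) = (1/2) ∑ m_i ‖v_i‖²`. -/
def kinetic (m : Fin N → ℝ) (v : Fin N → E) : ℝ :=
  1 / 2 * ∑ i, m i * ‖v i‖ ^ 2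

/-- The moment of inertia about the origin, `I(x) = ∑ m_i ‖r_i‖²`. -/
def inertia (m : Fin N → ℝ) (x : Fin N → E) : ℝ :=
  ∑ i, m i * ‖x i‖ ^ 2

/-- The set `Ω` of configurations without collisions. -/
def collisionFree (m : Fin N → ℝ) : Set (Fin N → E) :=
  {x | potential m x < ∞}

/-- The Lagrangian action of `γ` restricted to `[a, b]`, with values in `[0, ∞]`. An absolutely
continuous curve is differentiable at almost every `t` in `(a, b)`, and only the values of `γ` on
`[a, b]` matter. -/
def action (m : Fin N → ℝ) (γ : ℝ → Fin N → E) (a b : ℝ) : ℝ≥0∞ :=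
  ∫⁻ t in Icc a b, ENNReal.ofReal (kinetic m (deriv γ t)) + potential m (γ t)

/-- The critical action potential `φ(x, y)`: the infimum of the action over all absolutely
continuous curves from `x` to `y`, defined on any compact interval of positive length. -/
def criticalPotential (m : Fin N → ℝ) (x y : Fin N → E) : ℝ≥0∞ :=
  sInf {A | ∃ (γ : ℝ → Fin N → E) (a b : ℝ), a < b ∧ AbsolutelyContinuousOnInterval γ a b ∧
    γ a = x ∧ γ b = y ∧ A = action m γ a b}

/-- `γ` is a free time minimizer on the interval `J`: it is absolutely continuous on every compact
subinterval `[a, b]` of `J`, and its action there is `φ(γ(a), γ(b))`. -/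
def IsFreeTimeMinimizer (m : Fin N → ℝ) (γ : ℝ → Fin N → E) (J : Set ℝ) : Prop :=
  ∀ a b : ℝ, a < b → Icc a b ⊆ J →
    AbsolutelyContinuousOnInterval γ a b ∧ action m γ a b = criticalPotential m (γ a) (γ b)

/-- The function `g(t) = İ(t) I(t)^{-1/4}` along a curve on `[t₀, ∞)`; the derivative is one-sided
at `t₀`. -/
def gFun (m : Fin N → ℝ) (x : ℝ → Fin N → E) (t₀ t : ℝ) : ℝ :=
  derivWithin (fun s => inertia m (x s)) (Ici t₀) t * inertia m (x t) ^ (-(1 / 4) : ℝ)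

end NBody

end

/-! Write `I' = 2F` and `F' = V`, with `V` the potential along the minimizer. The proof never
derives Newton's equations; two families of competitors suffice. Linear changes of time show that
the kinetic energy `T` and `V` have equal integrals on every compact interval, so `T = V` almost
everywhere (`ae_kinetic_eq`). Homotheties `(1 + εη) x` then give a weak form of `I'' = 2V`
(`integral_homothety_eq_zero`), which tent functions upgrade to a classical identity
(`lagrange_jacobi`). Monotonicity: Cauchy-Schwarz and `T = V` give Sundman's inequality `F² ≤ 2IV`,
and `g' = I^(-5/4) (2IV - F²)`. Upper bound for `g`: a path through total collision gives `φ(x, y) ≤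
2 (I(x) + I(y)) / S + C S^(1/3)` for every `S > 0` (`criticalPotential_le`). The action of the
minimizer on `[t₀, t]` is `2 (F(t) - F(t₀))`, so a suitable `S` makes `F(t)` at most of order `(1 +
I(t₀) + I(t))^(1/4)`. If `F` is ever positive, `I` is nondecreasing from then on and `g` is bounded
above; otherwise `g ≤ 0`. The lower bound is `g(t₀)`. Finally `(I^(3/4))' = (3/4) g` is bounded
above, hence the growth `t^(4/3)`. -/

set_option linter.unusedSectionVars false

/-! ### Algebra of the potential, the kinetic energy and the moment of inertia. -/

namespace NBody

variable {E : Type*} [NormedAddCommGroup E] [InnerProductSpace ℝ E] {N : ℕ}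

/-- The Newtonian potential as a real number. -/
noncomputable def realPotential (m : Fin N → ℝ) (x : Fin N → E) : ℝ :=
  ∑ i, ∑ j ∈ Finset.Ioi i, m i * m j / ‖x i - x j‖

theorem kinetic_nonneg {m : Fin N → ℝ} (hm : ∀ i, 0 < m i) (v : Fin N → E) : 0 ≤ kinetic m v := by
  have := fun i => (hm i).le
  unfold kinetic
  exact mul_nonneg (by norm_num)
    (Finset.sum_nonneg fun i _ => mul_nonneg (this i) (by positivity))

theorem inertia_nonneg {m : Fin N → ℝ} (hm : ∀ i, 0 < m i) (x : Fin N → E) : 0 ≤ inertia m x :=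
  Finset.sum_nonneg fun i _ => mul_nonneg (hm i).le (by positivity)

theorem realPotential_nonneg {m : Fin N → ℝ} (hm : ∀ i, 0 < m i) (x : Fin N → E) :
    0 ≤ realPotential m x :=
  Finset.sum_nonneg fun i _ => Finset.sum_nonneg fun j _ =>
    div_nonneg (mul_nonneg (hm i).le (hm j).le) (norm_nonneg _)

theorem injective_of_mem_collisionFree {m : Fin N → ℝ} (hm : ∀ i, 0 < m i) {x : Fin N → E}
    (hx : x ∈ collisionFree m) : Function.Injective x := by
  have key : ∀ i j, i < j → x i ≠ x j := by
    intro i j hij h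
    have h1 : potential m x = ∞ := by
      refine ENNReal.sum_eq_top.2 ⟨i, Finset.mem_univ _, ENNReal.sum_eq_top.2
        ⟨j, Finset.mem_Ioi.2 hij, ?_⟩⟩
      rw [h, sub_self, norm_zero, ENNReal.ofReal_zero]
      exact ENNReal.div_zero (ENNReal.ofReal_pos.2 (mul_pos (hm i) (hm j))).ne'
    exact (lt_top_iff_ne_top.1 hx) h1
  intro i j h
  rcases lt_trichotomy i j with hij | hij | hij
  · exact absurd h (key i j hij)
  · exact hij
  · exact absurd h.symm (key j i hij)

theorem potential_eq_ofReal {m : Fin N → ℝ} (hm : ∀ i, 0 < m i) {x : Fin N → E}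
    (hx : Function.Injective x) : potential m x = ENNReal.ofReal (realPotential m x) := by
  have h0 : ∀ i j, 0 ≤ m i * m j / ‖x i - x j‖ := fun i j =>
    div_nonneg (mul_nonneg (hm i).le (hm j).le) (norm_nonneg _)
  unfold potential realPotential
  rw [ENNReal.ofReal_sum_of_nonneg fun i _ => Finset.sum_nonneg fun j _ => h0 i j]
  refine Finset.sum_congr rfl fun i _ => ?_
  rw [ENNReal.ofReal_sum_of_nonneg fun j _ => h0 i j]
  refine Finset.sum_congr rfl fun j hj => ?_
  rw [ENNReal.ofReal_div_of_pos]
  exact norm_pos_iff.2 (sub_ne_zero.2 fun h => (Finset.mem_Ioi.1 hj).ne (hx h))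

theorem realPotential_smul (m : Fin N → ℝ) {c : ℝ} (hc : 0 < c) (x : Fin N → E) :
    realPotential m (c • x) = realPotential m x / c := by
  unfold realPotential
  rw [Finset.sum_div]
  refine Finset.sum_congr rfl fun i _ => ?_
  rw [Finset.sum_div]
  refine Finset.sum_congr rfl fun j _ => ?_
  rw [Pi.smul_apply, Pi.smul_apply, ← smul_sub, norm_smul, Real.norm_of_nonneg hc.le, div_div,
    mul_comm c]

theorem realPotential_le {m : Fin N → ℝ} (hm : ∀ i, 0 < m i) {x : Fin N → E} {d : ℝ} (hd : 0 < d)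
    (h : ∀ i j, i ≠ j → d ≤ ‖x i - x j‖) :
    realPotential m x ≤ (∑ i, ∑ j ∈ Finset.Ioi i, m i * m j) * d⁻¹ := by
  unfold realPotential
  rw [Finset.sum_mul]
  refine Finset.sum_le_sum fun i _ => ?_
  rw [Finset.sum_mul]
  refine Finset.sum_le_sum fun j hj => ?_
  rw [div_eq_mul_inv]
  have := mul_pos (hm i) (hm j)
  have := h i j (Finset.mem_Ioi.1 hj).ne
  gcongr

theorem continuousOn_realPotential (m : Fin N → ℝ) {x : ℝ → Fin N → E} {s : Set ℝ}
    (hx : ContinuousOn x s) (h : ∀ t ∈ s, Function.Injective (x t)) :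
    ContinuousOn (fun t => realPotential m (x t)) s := by
  unfold realPotential
  refine continuousOn_finsetSum _ fun i _ => continuousOn_finsetSum _ fun j hj => ?_
  refine continuousOn_const.div ?_ fun t ht => ?_
  · exact ((continuousOn_pi.1 hx i).sub (continuousOn_pi.1 hx j)).norm
  · exact norm_ne_zero_iff.2 (sub_ne_zero.2 fun e => (Finset.mem_Ioi.1 hj).ne (h t ht e))

theorem kinetic_smul (m : Fin N → ℝ) (c : ℝ) (v : Fin N → E) :
    kinetic m (c • v) = c ^ 2 * kinetic m v := by
  unfold kinetic
  simp only [Pi.smul_apply, norm_smul, mul_pow, Real.norm_eq_abs, sq_abs, Finset.mul_sum]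
  exact Finset.sum_congr rfl fun i _ => by ring

/-- The mass inner product of two configurations. -/
noncomputable def massInner (m : Fin N → ℝ) (x v : Fin N → E) : ℝ :=
  ∑ i, m i * inner ℝ (x i) (v i)

/-- Used for the velocity of a homothetic variation, with `a = εη'` and `b = 1 + εη`. -/
theorem kinetic_smul_add_smul (m : Fin N → ℝ) (a b : ℝ) (x v : Fin N → E) :
    kinetic m (a • x + b • v) =
      1 / 2 * a ^ 2 * inertia m x + a * b * massInner m x v + b ^ 2 * kinetic m v := by
  unfold kinetic inertia massInner
  simp only [Finset.mul_sum, ← Finset.sum_add_distrib]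
  refine Finset.sum_congr rfl fun i _ => ?_
  rw [Pi.add_apply, Pi.smul_apply, Pi.smul_apply, norm_add_sq_real, norm_smul, norm_smul,
    real_inner_smul_left, real_inner_smul_right, mul_pow, mul_pow, Real.norm_eq_abs,
    Real.norm_eq_abs, sq_abs, sq_abs]
  ring

/-- Cauchy-Schwarz inequality for the mass inner product. -/
theorem massInner_sq_le {m : Fin N → ℝ} (hm : ∀ i, 0 < m i) (x v : Fin N → E) :
    massInner m x v ^ 2 ≤ inertia m x * (2 * kinetic m v) := by
  have h1 : massInner m x v ^ 2 ≤
      (∑ i, (Real.sqrt (m i) * ‖x i‖) * (Real.sqrt (m i) * ‖v i‖)) ^ 2 := by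
    refine sq_le_sq' ?_ ?_
    · rw [← Finset.sum_neg_distrib]
      refine Finset.sum_le_sum fun i _ => ?_
      have e : (Real.sqrt (m i) * ‖x i‖) * (Real.sqrt (m i) * ‖v i‖) = m i * (‖x i‖ * ‖v i‖) := by
        rw [mul_mul_mul_comm, Real.mul_self_sqrt (hm i).le]
      rw [e, ← mul_neg]
      exact mul_le_mul_of_nonneg_left (neg_le_of_abs_le (abs_real_inner_le_norm _ _)) (hm i).le
    · refine Finset.sum_le_sum fun i _ => ?_
      have e : (Real.sqrt (m i) * ‖x i‖) * (Real.sqrt (m i) * ‖v i‖) = m i * (‖x i‖ * ‖v i‖) := by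
        rw [mul_mul_mul_comm, Real.mul_self_sqrt (hm i).le]
      rw [e]
      exact mul_le_mul_of_nonneg_left (real_inner_le_norm _ _) (hm i).le
  refine h1.trans ((Finset.sum_mul_sq_le_sq_mul_sq _ _ _).trans_eq ?_)
  unfold inertia kinetic
  simp only [mul_pow, Real.sq_sqrt (hm _).le]
  ring

theorem hasDerivAt_inertia (m : Fin N → ℝ) {x : ℝ → Fin N → E} {v : Fin N → E} {t : ℝ}
    (h : HasDerivAt x v t) :
    HasDerivAt (fun s => inertia m (x s)) (2 * massInner m (x t) v) t := by
  unfold inertia massInner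
  rw [Finset.mul_sum]
  refine HasDerivAt.fun_sum fun i _ => ?_
  have := ((hasDerivAt_pi.1 h i).norm_sq).const_mul (m i)
  convert! this using 1
  ring

theorem measurable_kinetic_deriv [FiniteDimensional ℝ E] (m : Fin N → ℝ) (x : ℝ → Fin N → E) :
    Measurable fun t => kinetic m (deriv x t) := by
  have : StronglyMeasurable (deriv x) := stronglyMeasurable_deriv x
  have hc : Continuous fun v : Fin N → E => kinetic m v := by unfold kinetic; fun_prop
  exact (hc.comp_stronglyMeasurable this).measurable

/-- The action is bounded by the integral of any integrable majorant of the Lagrangian. -/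
theorem action_le_ofReal {m : Fin N → ℝ} {γ : ℝ → Fin N → E} {a b : ℝ} (hab : a ≤ b) {h : ℝ → ℝ}
    (hi : IntervalIntegrable h volume a b) (h0 : ∀ᵐ t, t ∈ Ioo a b → 0 ≤ h t)
    (hle : ∀ᵐ t, t ∈ Ioo a b →
      ENNReal.ofReal (kinetic m (deriv γ t)) + potential m (γ t) ≤ ENNReal.ofReal (h t)) :
    action m γ a b ≤ ENNReal.ofReal (∫ t in a..b, h t) := by
  unfold action
  rw [intervalIntegral.integral_of_le hab, integral_Ioc_eq_integral_Ioo,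
    ofReal_integral_eq_lintegral_ofReal, setLIntegral_congr Ioo_ae_eq_Icc.symm]
  · exact lintegral_mono_ae ((ae_restrict_iff' measurableSet_Ioo).2 hle)
  · exact ((intervalIntegrable_iff_integrableOn_Ioc_of_le hab).1 hi).mono_set Ioo_subset_Ioc_self
  · exact (ae_restrict_iff' measurableSet_Ioo).2 h0

end NBody

/-! ### Stability of absolute continuity under the operations that build competitors. -/

namespace AbsolutelyContinuousOnInterval

theorem congr {X : Type*} [PseudoMetricSpace X] {f g : ℝ → X} {a b : ℝ}
    (hf : AbsolutelyContinuousOnInterval f a b) (h : EqOn f g (uIcc a b)) :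
    AbsolutelyContinuousOnInterval g a b := by
  rw [absolutelyContinuousOnInterval_iff] at hf ⊢
  intro ε hε
  obtain ⟨δ, hδ, H⟩ := hf ε hε
  refine ⟨δ, hδ, fun I hI hlt => ?_⟩
  refine (Finset.sum_congr rfl fun i hi => ?_).trans_lt (H I hI hlt)
  rw [h (hI.1 i hi).1, h (hI.1 i hi).2]

theorem lipschitz_comp {X Y : Type*} [PseudoMetricSpace X] [PseudoMetricSpace Y] {f : ℝ → X}
    {g : X → Y} {K : NNReal} {a b : ℝ} (hg : LipschitzWith K g)
    (hf : AbsolutelyContinuousOnInterval f a b) :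
    AbsolutelyContinuousOnInterval (fun t => g (f t)) a b := by
  refine squeeze_zero (fun t => Finset.sum_nonneg fun i _ => dist_nonneg) (fun t => ?_)
    (by simpa using Filter.Tendsto.const_mul (K : ℝ) hf)
  rw [Finset.mul_sum]
  exact Finset.sum_le_sum fun i _ => hg.dist_le_mul _ _

theorem finset_sum {ι F : Type*} [NormedAddCommGroup F] {f : ι → ℝ → F} {a b : ℝ}
    (s : Finset ι) (hf : ∀ i ∈ s, AbsolutelyContinuousOnInterval (f i) a b) :
    AbsolutelyContinuousOnInterval (fun t => ∑ i ∈ s, f i t) a b := by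
  classical
  induction s using Finset.induction_on with
  | empty =>
    simpa using ((LipschitzWith.const (0 : F)).lipschitzOnWith
      (s := uIcc a b)).absolutelyContinuousOnInterval
  | insert i s hi ih =>
    simp only [Finset.sum_insert hi]
    exact (hf i (Finset.mem_insert_self _ _)).add
      (ih fun j hj => hf j (Finset.mem_insert_of_mem hj))

theorem smul_const {F : Type*} [NormedAddCommGroup F] [NormedSpace ℝ F] {f : ℝ → ℝ} {a b : ℝ}
    (hf : AbsolutelyContinuousOnInterval f a b) (v : F) :
    AbsolutelyContinuousOnInterval (fun t => f t • v) a b :=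
  hf.fun_smul ((LipschitzWith.const v).lipschitzOnWith
      (s := uIcc a b)).absolutelyContinuousOnInterval

theorem ae_differentiableAt_of_finiteDimensional {F : Type*} [NormedAddCommGroup F]
    [NormedSpace ℝ F] [FiniteDimensional ℝ F] {f : ℝ → F} {a b : ℝ}
    (hf : AbsolutelyContinuousOnInterval f a b) :
    ∀ᵐ t, t ∈ uIcc a b → DifferentiableAt ℝ f t :=
  hf.boundedVariationOn.ae_differentiableAt_of_mem_uIcc

/-- Absolute continuity under a linear change of parameter. -/
theorem comp_const_mul {X : Type*} [PseudoMetricSpace X] {f : ℝ → X} {a b c : ℝ} (hc : 0 < c)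
    (hf : AbsolutelyContinuousOnInterval f (c * a) (c * b)) :
    AbsolutelyContinuousOnInterval (fun t => f (c * t)) a b := by
  rw [absolutelyContinuousOnInterval_iff] at hf ⊢
  intro ε hε
  obtain ⟨δ, hδ, H⟩ := hf ε hε
  have hmem : ∀ u v t : ℝ, c * t ∈ uIcc (c * u) (c * v) ↔ t ∈ uIcc u v := by
    intro u v t
    rw [mem_uIcc, mem_uIcc]
    simp only [mul_le_mul_iff_right₀ hc]
  have hmem' : ∀ u v t : ℝ, t ∈ uIoc (c * u) (c * v) ↔ t / c ∈ uIoc u v := by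
    intro u v t
    rw [mem_uIoc, mem_uIoc]
    simp only [lt_div_iff₀' hc, div_le_iff₀' hc]
  refine ⟨δ / c, by positivity, fun I hI hlt => ?_⟩
  refine H (I.1, fun i => (c * (I.2 i).1, c * (I.2 i).2)) ⟨fun i hi => ?_, ?_⟩ ?_
  · exact ⟨(hmem _ _ _).2 (hI.1 i hi).1, (hmem _ _ _).2 (hI.1 i hi).2⟩
  · intro i hi j hj hij
    refine Set.disjoint_left.2 fun t h1 h2 => ?_
    exact Set.disjoint_left.1 (hI.2 hi hj hij) ((hmem' _ _ _).1 h1) ((hmem' _ _ _).1 h2)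
  · rw [lt_div_iff₀' hc, Finset.mul_sum] at hlt
    refine (Finset.sum_congr rfl fun i _ => ?_).trans_lt hlt
    rw [Real.dist_eq, Real.dist_eq, ← mul_sub, abs_mul, abs_of_pos hc]

theorem comp_neg {X : Type*} [PseudoMetricSpace X] {f : ℝ → X} {a b : ℝ}
    (hf : AbsolutelyContinuousOnInterval f (-a) (-b)) :
    AbsolutelyContinuousOnInterval (fun t => f (-t)) a b := by
  rw [absolutelyContinuousOnInterval_iff] at hf ⊢
  intro ε hε
  obtain ⟨δ, hδ, H⟩ := hf ε hε
  have hmem : ∀ t : ℝ, t ∈ uIcc a b → -t ∈ uIcc (-a) (-b) := by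
    intro t
    simp only [mem_uIcc, neg_le_neg_iff]
    tauto
  refine ⟨δ, hδ, fun I hI hlt => H (I.1, fun i => (-(I.2 i).1, -(I.2 i).2)) ⟨fun i hi => ?_, ?_⟩ ?_⟩
  · exact ⟨hmem _ (hI.1 i hi).1, hmem _ (hI.1 i hi).2⟩
  · intro i hi j hj hij
    refine Set.disjoint_left.2 fun t h1 h2 => ?_
    simp only [uIoc, mem_Ioc, min_neg_neg, max_neg_neg] at h1 h2
    -- Reflection moves the closed end of a half-open interval, so `-t` itself may be excluded. The
    -- smaller of the two right endpoints lies in both original intervals.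
    refine Set.disjoint_left.1 (hI.2 hi hj hij)
      (?_ : min (max (I.2 i).1 (I.2 i).2) (max (I.2 j).1 (I.2 j).2) ∈ _) ?_
    · exact ⟨lt_min (by linarith) (by linarith), min_le_left _ _⟩
    · exact ⟨lt_min (by linarith) (by linarith), min_le_right _ _⟩
  · simpa using hlt

end AbsolutelyContinuousOnInterval

namespace NBody

variable {E : Type*} [NormedAddCommGroup E] [InnerProductSpace ℝ E] {N : ℕ}

theorem absolutelyContinuousOnInterval_inertia (m : Fin N → ℝ) {x : ℝ → Fin N → E} {a b : ℝ}
    (hx : AbsolutelyContinuousOnInterval x a b) :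
    AbsolutelyContinuousOnInterval (fun t => inertia m (x t)) a b := by
  refine AbsolutelyContinuousOnInterval.finset_sum _ fun i _ => ?_
  have h : AbsolutelyContinuousOnInterval (fun t => ‖x t i‖) a b :=
    AbsolutelyContinuousOnInterval.lipschitz_comp (g := fun v : Fin N → E => ‖v i‖)
      (lipschitzWith_one_norm.comp (LipschitzWith.eval i)) hx
  simpa only [pow_two] using! (h.fun_mul h).const_mul (m i)

end NBody

/-! ### The scalar profile of a path leaving total collision. -/

namespace NBody

/-- The function `(s (S - s) / S) ^ (2 / 3)` on `[0, S]`, extended by `0` to the left. -/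
noncomputable def bump (S s : ℝ) : ℝ := (max s 0 * (S - max s 0) / S) ^ (2 / 3 : ℝ)

/-- The derivative of `bump S` on `(-S, S)` away from `0`. -/
noncomputable def bumpDeriv (S s : ℝ) : ℝ :=
  if 0 < s then (1 - 2 * s / S) * (2 / 3) * (s * (S - s) / S) ^ (-(1 / 3) : ℝ) else 0

/-- An integrable majorant of `1 / bump` and of `bumpDeriv ^ 2`. -/
noncomputable def bumpMajorant (S s : ℝ) : ℝ :=
  |s| ^ (-(2 / 3) : ℝ) + (S - |s|) ^ (-(2 / 3) : ℝ)

theorem bump_of_nonpos (S : ℝ) {s : ℝ} (hs : s ≤ 0) : bump S s = 0 := by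
  simp [bump, max_eq_right hs]

theorem bump_self (S : ℝ) (hS : 0 < S) : bump S S = 0 := by
  simp [bump, max_eq_left hS.le]

theorem bump_of_pos (S : ℝ) {s : ℝ} (hs : 0 < s) :
    bump S s = (s * (S - s) / S) ^ (2 / 3 : ℝ) := by
  simp [bump, max_eq_left hs.le]

theorem bump_pos {S s : ℝ} (hs : s ∈ Ioo 0 S) : 0 < bump S s := by
  rw [bump_of_pos S hs.1]
  have := sub_pos.2 hs.2
  have := hs.1
  have := hs.1.trans hs.2
  positivity

theorem continuous_bump (S : ℝ) : Continuous (bump S) := by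
  unfold bump
  exact Continuous.rpow_const (by fun_prop) fun s => Or.inr (by norm_num)

theorem hasDerivAt_bump {S s : ℝ} (hs : s ∈ Ioo 0 S) :
    HasDerivAt (bump S) (bumpDeriv S s) s := by
  have h0 := hs.1
  have hS := hs.1.trans hs.2
  have h1 := sub_pos.2 hs.2
  have hq : HasDerivAt (fun u : ℝ => u * (S - u) / S) (1 - 2 * s / S) s := by
    have := (((hasDerivAt_id s).mul ((hasDerivAt_const s S).sub (hasDerivAt_id s))).div_const S)
    convert! this using 1
    simp only [id]
    field_simp
    simp
    ring
  have := hq.rpow_const (p := 2 / 3) (Or.inl (by positivity))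
  rw [bumpDeriv, if_pos h0]
  refine HasDerivAt.congr_of_eventuallyEq (by convert! this using 2; norm_num) ?_
  filter_upwards [lt_mem_nhds h0] with u hu using bump_of_pos S hu

theorem bumpMajorant_nonneg {S s : ℝ} (hs : s ∈ Ioo (-S) S) : 0 ≤ bumpMajorant S s := by
  have := sub_pos.2 (abs_lt.2 hs)
  unfold bumpMajorant
  positivity

theorem bumpMajorant_neg (S s : ℝ) : bumpMajorant S (-s) = bumpMajorant S s := by
  simp [bumpMajorant]

/-- The inverse of `s (S - s) / S` is `1/s + 1/(S - s)`, and `u ↦ u^(2/3)` is subadditive. -/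
theorem rpow_neg_le_bumpMajorant {S s : ℝ} (hs : s ∈ Ioo 0 S) :
    (s * (S - s) / S) ^ (-(2 / 3) : ℝ) ≤ bumpMajorant S s := by
  have h0 := hs.1
  have hS := hs.1.trans hs.2
  have h1 := sub_pos.2 hs.2
  have e : (s * (S - s) / S)⁻¹ = s⁻¹ + (S - s)⁻¹ := by field_simp; ring
  rw [bumpMajorant, abs_of_pos h0, Real.rpow_neg (by positivity), Real.rpow_neg h0.le,
    Real.rpow_neg h1.le, ← Real.inv_rpow (by positivity), ← Real.inv_rpow h0.le,
    ← Real.inv_rpow h1.le, e]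
  exact Real.rpow_add_le_add_rpow (by positivity) (by positivity) (by norm_num) (by norm_num)

theorem inv_bump_le {S s : ℝ} (hs : s ∈ Ioo 0 S) : (bump S s)⁻¹ ≤ bumpMajorant S s := by
  have h0 := hs.1
  have hS := hs.1.trans hs.2
  have h1 := sub_pos.2 hs.2
  rw [bump_of_pos S h0, ← Real.rpow_neg (by positivity)]
  exact rpow_neg_le_bumpMajorant hs

theorem bumpDeriv_sq_le {S s : ℝ} (hs : s ∈ Ioo (-S) S) :
    bumpDeriv S s ^ 2 ≤ bumpMajorant S s := by
  by_cases h0 : 0 < s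
  · have hS := h0.trans hs.2
    have h1 := sub_pos.2 hs.2
    refine le_trans ?_ (rpow_neg_le_bumpMajorant ⟨h0, hs.2⟩)
    have hq : 0 < s * (S - s) / S := by positivity
    have e : ((s * (S - s) / S) ^ (-(1 / 3) : ℝ)) ^ 2 = (s * (S - s) / S) ^ (-(2 / 3) : ℝ) := by
      rw [← Real.rpow_natCast, ← Real.rpow_mul hq.le]
      norm_num
    rw [bumpDeriv, if_pos h0, mul_pow, e]
    refine mul_le_of_le_one_left (by positivity) ?_
    have h2 : 0 < s / S := by positivity
    have h3 : s / S < 1 := (div_lt_one hS).2 hs.2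
    rw [mul_div_assoc]
    nlinarith
  · rw [bumpDeriv, if_neg h0]
    simpa using bumpMajorant_nonneg hs

/-- The exponent `2/3` is that of parabolic motion: kinetic and potential terms both blow up like
`s^(-2/3)`, which is integrable, and the integral scales as `S^(1/3)`. -/
theorem integral_bumpMajorant {S : ℝ} (hS : 0 < S) :
    IntervalIntegrable (bumpMajorant S) volume (-S) S ∧
      ∫ s in (-S)..S, bumpMajorant S s = 12 * S ^ (1 / 3 : ℝ) := by
  have hr : IntervalIntegrable (fun s : ℝ => s ^ (-(2 / 3) : ℝ)) volume 0 S :=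
    intervalIntegral.intervalIntegrable_rpow' (by norm_num)
  have hr' : IntervalIntegrable (fun s : ℝ => (S - s) ^ (-(2 / 3) : ℝ)) volume 0 S := by
    have := hr.comp_sub_left S
    simpa using this.symm
  have hI : ∫ s in (0 : ℝ)..S, s ^ (-(2 / 3) : ℝ) = 3 * S ^ (1 / 3 : ℝ) := by
    rw [integral_rpow (Or.inl (by norm_num))]
    norm_num
    ring
  have hI' : ∫ s in (0 : ℝ)..S, (S - s) ^ (-(2 / 3) : ℝ) = 3 * S ^ (1 / 3 : ℝ) := by
    rw [← hI, intervalIntegral.integral_comp_sub_left (fun u : ℝ => u ^ (-(2 / 3) : ℝ))]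
    simp
  have hcongr : EqOn (bumpMajorant S)
      (fun s => s ^ (-(2 / 3) : ℝ) + (S - s) ^ (-(2 / 3) : ℝ)) (uIcc 0 S) := by
    intro s hs
    rw [uIcc_of_le hS.le] at hs
    simp only [bumpMajorant, abs_of_nonneg hs.1]
  have h2 : IntervalIntegrable (bumpMajorant S) volume 0 S :=
    (hr.add hr').congr (fun s hs => (hcongr (uIoc_subset_uIcc hs)).symm)
  have h2' : ∫ s in (0 : ℝ)..S, bumpMajorant S s = 6 * S ^ (1 / 3 : ℝ) := by
    rw [intervalIntegral.integral_congr hcongr, intervalIntegral.integral_add hr hr', hI, hI']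
    ring
  have h1 : IntervalIntegrable (bumpMajorant S) volume (-S) 0 := by
    have := (h2.comp_sub_left 0).symm
    simpa [bumpMajorant_neg] using this
  have h1' : ∫ s in (-S)..0, bumpMajorant S s = 6 * S ^ (1 / 3 : ℝ) := by
    have := intervalIntegral.integral_comp_neg (a := 0) (b := S) (bumpMajorant S)
    simp only [bumpMajorant_neg, neg_zero] at this
    rw [← this, h2']
  refine ⟨h1.trans h2, ?_⟩
  rw [← intervalIntegral.integral_add_adjacent_intervals h1 h2, h1', h2']
  ring

/-- The slope is infinite at `0` and at `S`, so no Lipschitz bound is available. Instead the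
function is the integral of its integrable derivative. -/
theorem absolutelyContinuousOnInterval_bump {S : ℝ} (hS : 0 < S) :
    AbsolutelyContinuousOnInterval (bump S) (-S) S := by
  have hle : -S ≤ S := by linarith
  have hi : IntervalIntegrable (bumpDeriv S) volume (-S) S := by
    refine ((intervalIntegrable_const (c := (1 : ℝ))).add (integral_bumpMajorant hS).1).mono_fun
      ?_ ?_
    · have : Measurable (bumpDeriv S) := by
        unfold bumpDeriv
        exact Measurable.ite measurableSet_Ioi (by fun_prop) measurable_const
      exact this.aestronglyMeasurable
    · rw [uIoc_of_le hle, Filter.EventuallyLE]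
      rw [ae_restrict_iff' measurableSet_Ioc]
      have hne : ∀ᵐ s : ℝ, s ≠ S := by simp [ae_iff, measure_singleton]
      filter_upwards [hne] with s hs hs'
      have hs'' : s ∈ Ioo (-S) S := ⟨hs'.1, lt_of_le_of_ne hs'.2 hs⟩
      have h1 := bumpDeriv_sq_le hs''
      have h2 := bumpMajorant_nonneg hs''
      rw [Real.norm_eq_abs, Real.norm_of_nonneg (by positivity)]
      -- Uses `|d| ≤ 1 + d²` to pass from the bound on the square to integrability.
      nlinarith [sq_abs (bumpDeriv S s), sq_nonneg (|bumpDeriv S s| - 1)]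
  refine (hi.absolutelyContinuousOnInterval_intervalIntegral (left_mem_uIcc)).congr ?_
  intro t ht
  rw [uIcc_of_le hle] at ht
  have := integral_eq_of_hasDerivAt_off_countable_of_le (bump S) (bumpDeriv S) ht.1
    (countable_singleton (0 : ℝ)) (continuous_bump S).continuousOn ?_
    (hi.mono_set (by rw [uIcc_of_le ht.1, uIcc_of_le hle]; exact Icc_subset_Icc_right ht.2))
  · simpa only [bump_of_nonpos S (neg_nonpos.2 hS.le), sub_zero] using this
  · rintro s ⟨hs, hs0⟩
    rcases lt_or_gt_of_ne (show s ≠ 0 from hs0) with h | h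
    · rw [bumpDeriv, if_neg h.le.not_gt]
      refine (hasDerivAt_const s (0 : ℝ)).congr_of_eventuallyEq ?_
      filter_upwards [gt_mem_nhds h] with u hu using bump_of_nonpos S (le_of_lt hu)
    · exact hasDerivAt_bump ⟨h, hs.2.trans_le ht.2⟩

/-- Every finite family of reals admits a strict ranking compatible with its order. -/
theorem exists_ranking {N : ℕ} (a : Fin N → ℝ) :
    ∃ l : Fin N → ℝ, (∀ i, l i ^ 2 ≤ (N : ℝ) ^ 2) ∧
      ∀ i j, i ≠ j → 1 ≤ |l i - l j| ∧ 0 ≤ (a i - a j) * (l i - l j) := by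
  let σ := (Tuple.sort a).symm
  have hmono : ∀ i j, σ i < σ j → a i ≤ a j := by
    intro i j h
    have := Tuple.monotone_sort a h.le
    simpa [σ] using this
  refine ⟨fun i => ((σ i : ℕ) : ℝ), fun i => ?_, fun i j hij => ?_⟩
  · have : ((σ i : ℕ) : ℝ) ≤ N := by exact_mod_cast (σ i).isLt.le
    gcongr
  · have hne : σ i ≠ σ j := fun h => hij (σ.injective h)
    rcases lt_or_gt_of_ne hne with h | h
    · have h1 : ((σ i : ℕ) : ℝ) + 1 ≤ (σ j : ℕ) := by exact_mod_cast h
      refine ⟨?_, ?_⟩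
      · rw [abs_sub_comm]
        exact (by linarith : (1 : ℝ) ≤ _).trans (le_abs_self _)
      · exact mul_nonneg_of_nonpos_of_nonpos (sub_nonpos.2 (hmono i j h)) (by linarith)
    · have h1 : ((σ j : ℕ) : ℝ) + 1 ≤ (σ i : ℕ) := by exact_mod_cast h
      refine ⟨(by linarith : (1 : ℝ) ≤ _).trans (le_abs_self _), ?_⟩
      exact mul_nonneg (sub_nonneg.2 (hmono j i h)) (by linarith)

/-! ### Upper bound for the critical potential by a path through total collision. -/

variable {E : Type*} [NormedAddCommGroup E] [InnerProductSpace ℝ E] {N : ℕ}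

/-- A curve that stays at the total collision for negative times and reaches `y` at time `S`, with
bodies kept apart in the direction `e` according to the ranking `l`. -/
noncomputable def halfCurve (S : ℝ) (y : Fin N → E) (l : Fin N → ℝ) (e : E) (s : ℝ) : Fin N → E :=
  (max s 0 / S) • y + bump S s • fun i => l i • e

theorem halfCurve_of_nonpos (S : ℝ) (y : Fin N → E) (l : Fin N → ℝ) (e : E) {s : ℝ} (hs : s ≤ 0) :
    halfCurve S y l e s = 0 := by
  simp [halfCurve, bump_of_nonpos S hs, max_eq_right hs]

theorem halfCurve_self {S : ℝ} (hS : 0 < S) (y : Fin N → E) (l : Fin N → ℝ) (e : E) :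
    halfCurve S y l e S = y := by
  simp [halfCurve, bump_self S hS, max_eq_left hS.le, hS.ne']

theorem absolutelyContinuousOnInterval_halfCurve {S : ℝ} (hS : 0 < S) (y : Fin N → E)
    (l : Fin N → ℝ) (e : E) : AbsolutelyContinuousOnInterval (halfCurve S y l e) (-S) S := by
  have h : AbsolutelyContinuousOnInterval (fun s : ℝ => max s 0 / S) (-S) S := by
    have h1 : LipschitzWith 1 fun s : ℝ => max s 0 := LipschitzWith.id.max_const 0
    have h2 := (h1.lipschitzOnWith (s := uIcc (-S) S)).absolutelyContinuousOnInterval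
    simpa only [div_eq_inv_mul] using h2.const_mul S⁻¹
  exact (h.smul_const y).add ((absolutelyContinuousOnInterval_bump hS).smul_const _)

theorem kinetic_add_le {m : Fin N → ℝ} (hm : ∀ i, 0 < m i) (u v : Fin N → E) :
    kinetic m (u + v) ≤ 2 * kinetic m u + 2 * kinetic m v := by
  unfold kinetic
  simp only [Finset.mul_sum, ← Finset.sum_add_distrib]
  refine Finset.sum_le_sum fun i _ => ?_
  have h : ‖(u + v) i‖ ^ 2 ≤ 2 * ‖u i‖ ^ 2 + 2 * ‖v i‖ ^ 2 := by
    have h1 : ‖(u + v) i‖ ≤ ‖u i‖ + ‖v i‖ := norm_add_le _ _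
    nlinarith [norm_nonneg ((u + v) i), sq_nonneg (‖u i‖ - ‖v i‖)]
  nlinarith [mul_le_mul_of_nonneg_left h (hm i).le]

/-- A constant, depending on the masses only, in the upper bound for the critical potential. -/
noncomputable def actionConst (m : Fin N → ℝ) : ℝ :=
  (N : ℝ) ^ 2 * ∑ i, m i + ∑ i, ∑ j ∈ Finset.Ioi i, m i * m j

theorem actionConst_nonneg {m : Fin N → ℝ} (hm : ∀ i, 0 < m i) : 0 ≤ actionConst m :=
  add_nonneg (mul_nonneg (by positivity) (Finset.sum_nonneg fun i _ => (hm i).le))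
    (Finset.sum_nonneg fun i _ => Finset.sum_nonneg fun j _ => (mul_pos (hm i) (hm j)).le)

/-- Since the ranking `l` agrees with the order of the projections of `y` on `e`, the homothetic
term and the bump separate any two bodies in the same direction along `e`. Hence mutual distances
are at least `bump S s`, whatever collisions `y` has. -/
theorem exists_hasDerivAt_halfCurve {m : Fin N → ℝ} (hm : ∀ i, 0 < m i) {S s : ℝ}
    (hs : s ∈ Ioo 0 S) (y : Fin N → E) {l : Fin N → ℝ} {e : E} (he : ‖e‖ = 1)
    (hl : ∀ i, l i ^ 2 ≤ (N : ℝ) ^ 2)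
    (hl' : ∀ i j, i ≠ j →
      1 ≤ |l i - l j| ∧ 0 ≤ (inner ℝ e (y i) - inner ℝ e (y j)) * (l i - l j)) :
    ∃ v, HasDerivAt (halfCurve S y l e) v s ∧
      ENNReal.ofReal (kinetic m v) + potential m (halfCurve S y l e s) ≤
        ENNReal.ofReal (inertia m y / S ^ 2 + actionConst m * bumpMajorant S s) := by
  have h0 := hs.1
  have hS := hs.1.trans hs.2
  have hs' : s ∈ Ioo (-S) S := ⟨by linarith, hs.2⟩
  refine ⟨S⁻¹ • y + bumpDeriv S s • fun i => l i • e, ?_, ?_⟩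
  · have h1 : HasDerivAt (fun u : ℝ => max u 0 / S) S⁻¹ s := by
      rw [← one_div]
      refine ((hasDerivAt_id s).div_const S).congr_of_eventuallyEq ?_
      filter_upwards [lt_mem_nhds h0] with u hu
      rw [max_eq_left (le_of_lt hu), id]
    exact (h1.smul_const y).add ((hasDerivAt_bump hs).smul_const _)
  have hM := bumpMajorant_nonneg hs'
  have hkin : kinetic m (S⁻¹ • y + bumpDeriv S s • fun i => l i • e) ≤
      inertia m y / S ^ 2 + (N : ℝ) ^ 2 * (∑ i, m i) * bumpMajorant S s := by
    refine (kinetic_add_le hm _ _).trans ?_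
    rw [kinetic_smul, kinetic_smul]
    have e1 : 2 * (S⁻¹ ^ 2 * kinetic m y) = inertia m y / S ^ 2 := by
      unfold kinetic inertia
      field_simp
    have e2 : 2 * kinetic m (fun i => l i • e) ≤ (N : ℝ) ^ 2 * ∑ i, m i := by
      unfold kinetic
      rw [← mul_assoc, mul_one_div_cancel two_ne_zero, one_mul, Finset.mul_sum]
      refine Finset.sum_le_sum fun i _ => ?_
      rw [norm_smul, he, mul_one, Real.norm_eq_abs, sq_abs, mul_comm]
      exact mul_le_mul_of_nonneg_right (hl i) (hm i).le
    have e3 : 0 ≤ 2 * kinetic m (fun i => l i • e) := by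
      have := kinetic_nonneg hm (fun i => l i • e)
      positivity
    rw [e1]
    refine add_le_add le_rfl ?_
    calc 2 * (bumpDeriv S s ^ 2 * kinetic m fun i => l i • e)
        = (2 * kinetic m fun i => l i • e) * bumpDeriv S s ^ 2 := by ring
      _ ≤ ((N : ℝ) ^ 2 * ∑ i, m i) * bumpMajorant S s :=
        mul_le_mul e2 (bumpDeriv_sq_le hs') (sq_nonneg _) (e3.trans e2)
  have hb := bump_pos hs
  have hdist : ∀ i j, i ≠ j →
      bump S s ≤ ‖halfCurve S y l e s i - halfCurve S y l e s j‖ := by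
    intro i j hij
    obtain ⟨h1, h2⟩ := hl' i j hij
    have hinner : inner ℝ e (halfCurve S y l e s i - halfCurve S y l e s j) =
        s / S * (inner ℝ e (y i) - inner ℝ e (y j)) + bump S s * (l i - l j) := by
      simp only [halfCurve, max_eq_left h0.le, Pi.add_apply, Pi.smul_apply, inner_sub_right,
        inner_add_right, real_inner_smul_right, real_inner_self_eq_norm_sq, he]
      ring
    have hle : |inner ℝ e (halfCurve S y l e s i - halfCurve S y l e s j)| ≤
        ‖halfCurve S y l e s i - halfCurve S y l e s j‖ := by
      simpa [he] using abs_real_inner_le_norm e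
        (halfCurve S y l e s i - halfCurve S y l e s j)
    refine le_trans ?_ hle
    rw [hinner]
    -- The two summands have a nonnegative product, so the absolute value of their sum is at least
    -- that of the second.
    have h3 : 0 ≤ s / S * (inner ℝ e (y i) - inner ℝ e (y j)) * (bump S s * (l i - l j)) := by
      have : 0 ≤ s / S * bump S s *
        ((inner ℝ e (y i) - inner ℝ e (y j)) * (l i - l j)) := by positivity
      linarith
    have h4 : bump S s ≤ |bump S s * (l i - l j)| := by
      rw [abs_mul, abs_of_pos hb]
      exact le_mul_of_one_le_right hb.le h1
    refine h4.trans (sq_le_sq.1 ?_)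
    nlinarith [sq_nonneg (s / S * (inner ℝ e (y i) - inner ℝ e (y j)))]
  have hinj : Function.Injective (halfCurve S y l e s) := by
    intro i j h
    by_contra hij
    have := hdist i j hij
    rw [h, sub_self, norm_zero] at this
    exact this.not_gt hb
  have hpot : realPotential m (halfCurve S y l e s) ≤
      (∑ i, ∑ j ∈ Finset.Ioi i, m i * m j) * bumpMajorant S s := by
    refine (realPotential_le hm hb hdist).trans ?_
    refine mul_le_mul_of_nonneg_left (inv_bump_le hs) ?_
    exact Finset.sum_nonneg fun i _ => Finset.sum_nonneg fun j _ => (mul_pos (hm i) (hm j)).le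
  rw [potential_eq_ofReal hm hinj,
    ← ENNReal.ofReal_add (kinetic_nonneg hm _) (realPotential_nonneg hm _)]
  refine ENNReal.ofReal_le_ofReal ?_
  unfold actionConst
  linarith

/-- Upper bound for the critical potential, obtained from a curve through the total collision. -/
theorem criticalPotential_le {m : Fin N → ℝ} (hm : ∀ i, 0 < m i) [Nontrivial E]
    (x y : Fin N → E) {S : ℝ} (hS : 0 < S) :
    criticalPotential m x y ≤ ENNReal.ofReal
      (2 * (inertia m x + inertia m y) / S + 12 * actionConst m * S ^ (1 / 3 : ℝ)) := by
  obtain ⟨e, he⟩ := exists_norm_eq E zero_le_one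
  obtain ⟨k, hk, hk'⟩ := exists_ranking fun i => inner ℝ e (x i)
  obtain ⟨l, hl, hl'⟩ := exists_ranking fun i => inner ℝ e (y i)
  have hle : -S ≤ S := by linarith
  have hIx := inertia_nonneg hm x
  have hIy := inertia_nonneg hm y
  -- Each half vanishes where the other is active, so this sum is the concatenation: fall from `x`
  -- to total collision at time `0`, then ejection to `y`.
  let γ : ℝ → Fin N → E := fun s => halfCurve S x k e (-s) + halfCurve S y l e s
  have hac : AbsolutelyContinuousOnInterval γ (-S) S := by
    refine AbsolutelyContinuousOnInterval.fun_add ?_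
      (absolutelyContinuousOnInterval_halfCurve hS y l e)
    have h := (absolutelyContinuousOnInterval_halfCurve hS x k e).symm
    exact AbsolutelyContinuousOnInterval.comp_neg (by rwa [neg_neg])
  have hγa : γ (-S) = x := by
    simp [γ, halfCurve_of_nonpos S y l e (neg_nonpos.2 hS.le), halfCurve_self hS]
  have hγb : γ S = y := by
    simp [γ, halfCurve_of_nonpos S x k e (neg_nonpos.2 hS.le), halfCurve_self hS]
  let h : ℝ → ℝ := fun s =>
    (inertia m x + inertia m y) / S ^ 2 + actionConst m * bumpMajorant S s
  obtain ⟨hi, hval⟩ := integral_bumpMajorant hS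
  have hint : ∫ s in (-S)..S, h s =
      2 * (inertia m x + inertia m y) / S + 12 * actionConst m * S ^ (1 / 3 : ℝ) := by
    rw [intervalIntegral.integral_add intervalIntegrable_const (hi.const_mul _),
      intervalIntegral.integral_const, intervalIntegral.integral_const_mul, hval, smul_eq_mul]
    field_simp
    ring
  have hφ : criticalPotential m x y ≤ action m γ (-S) S :=
    sInf_le ⟨γ, -S, S, by linarith, hac, hγa, hγb, rfl⟩
  refine hφ.trans ?_
  rw [← hint]
  refine action_le_ofReal hle (intervalIntegrable_const.add (hi.const_mul _)) ?_ ?_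
  · refine Filter.Eventually.of_forall fun s hs => ?_
    exact add_nonneg (by positivity) (mul_nonneg (actionConst_nonneg hm) (bumpMajorant_nonneg hs))
  · have hne : ∀ᵐ s : ℝ, s ≠ 0 := by simp [ae_iff, measure_singleton]
    filter_upwards [hne] with s hs0 hs
    rcases lt_or_gt_of_ne hs0 with hneg | hpos
    · obtain ⟨v, hv, hb⟩ := exists_hasDerivAt_halfCurve hm (S := S) (s := -s)
        ⟨by linarith, by linarith [hs.1]⟩ x he hk hk'
      have hd : HasDerivAt γ (-v) s := by
        have hv' := HasDerivAt.scomp s hv (hasDerivAt_neg s)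
        rw [neg_one_smul] at hv'
        refine hv'.congr_of_eventuallyEq ?_
        filter_upwards [gt_mem_nhds hneg] with u hu
        simp [γ, halfCurve_of_nonpos S y l e (le_of_lt hu)]
      have hγs : γ s = halfCurve S x k e (-s) := by
        simp [γ, halfCurve_of_nonpos S y l e hneg.le]
      have hkn : kinetic m (-v) = kinetic m v := by simp [kinetic]
      rw [hd.deriv, hγs, hkn]
      refine hb.trans (ENNReal.ofReal_le_ofReal ?_)
      rw [bumpMajorant_neg]
      simp only [h]
      gcongr
      linarith
    · obtain ⟨v, hv, hb⟩ := exists_hasDerivAt_halfCurve hm (S := S) (s := s)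
        ⟨hpos, hs.2⟩ y he hl hl'
      have hd : HasDerivAt γ v s := by
        refine hv.congr_of_eventuallyEq ?_
        filter_upwards [lt_mem_nhds hpos] with u hu
        simp [γ, halfCurve_of_nonpos S x k e (neg_nonpos.2 (le_of_lt hu))]
      have hγs : γ s = halfCurve S y l e s := by
        simp [γ, halfCurve_of_nonpos S x k e (neg_nonpos.2 hpos.le)]
      rw [hd.deriv, hγs]
      refine hb.trans (ENNReal.ofReal_le_ofReal ?_)
      simp only [h]
      gcongr
      linarith

end NBody

/-! ### Variations of a free time minimizer: zero energy and homotheties. -/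

namespace NBody

variable {E : Type*} [NormedAddCommGroup E] [InnerProductSpace ℝ E] {N : ℕ}

theorem nontrivial_of_injective (hN : 2 ≤ N) {x : Fin N → E} (hx : Function.Injective x) :
    Nontrivial E := by
  refine ⟨x ⟨0, by omega⟩, x ⟨1, by omega⟩, fun h => ?_⟩
  simpa using hx h

theorem inertia_pos {m : Fin N → ℝ} (hm : ∀ i, 0 < m i) (hN : 2 ≤ N) {x : Fin N → E}
    (hx : Function.Injective x) : 0 < inertia m x := by
  refine lt_of_le_of_ne (inertia_nonneg hm x) fun h => ?_
  have h0 := (Finset.sum_eq_zero_iff_of_nonneg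
    (fun i _ => mul_nonneg (hm i).le (by positivity))).1 h.symm
  have hz : ∀ i, x i = 0 := fun i => by
    simpa [(hm i).ne'] using h0 i (Finset.mem_univ i)
  have := hx ((hz ⟨0, by omega⟩).trans (hz ⟨1, by omega⟩).symm)
  simp at this

variable [FiniteDimensional ℝ E] {m : Fin N → ℝ} {x : ℝ → Fin N → E} {t₀ : ℝ}

theorem IsFreeTimeMinimizer.continuousOn (hx : IsFreeTimeMinimizer m x (Ici t₀)) :
    ContinuousOn x (Ici t₀) := by
  intro t ht
  have h := (hx t₀ (t + 1) (by linarith [mem_Ici.1 ht]) Icc_subset_Ici_self).1.continuousOn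
  rw [uIcc_of_le (by linarith [mem_Ici.1 ht])] at h
  refine (h t ⟨ht, by linarith⟩).mono_of_mem_nhdsWithin ?_
  rw [← Ici_inter_Iic]
  exact Filter.inter_mem self_mem_nhdsWithin (mem_nhdsWithin_of_mem_nhds (Iic_mem_nhds (by linarith)))

theorem IsFreeTimeMinimizer.continuousOn_realPotential (hm : ∀ i, 0 < m i)
    (hx : IsFreeTimeMinimizer m x (Ici t₀)) (hΩ : ∀ t, t₀ ≤ t → x t ∈ collisionFree m) :
    ContinuousOn (fun t => realPotential m (x t)) (Ici t₀) :=
  NBody.continuousOn_realPotential m hx.continuousOn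
    fun t ht => injective_of_mem_collisionFree hm (hΩ t ht)

theorem IsFreeTimeMinimizer.intervalIntegrable_realPotential (hm : ∀ i, 0 < m i)
    (hx : IsFreeTimeMinimizer m x (Ici t₀)) (hΩ : ∀ t, t₀ ≤ t → x t ∈ collisionFree m)
    {a b : ℝ} (ha : t₀ ≤ a) (hab : a < b) :
    IntervalIntegrable (fun t => realPotential m (x t)) volume a b := by
  refine ((hx.continuousOn_realPotential hm hΩ).mono ?_).intervalIntegrable
  rw [uIcc_of_le hab.le]
  exact fun t ht => ha.trans ht.1

/-- The action of a minimizer equals a value of `φ`, which is finite by `criticalPotential_le`. -/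
theorem IsFreeTimeMinimizer.intervalIntegrable_kinetic (hm : ∀ i, 0 < m i) [Nontrivial E]
    (hx : IsFreeTimeMinimizer m x (Ici t₀))
    {a b : ℝ} (ha : t₀ ≤ a) (hab : a < b) :
    IntervalIntegrable (fun t => kinetic m (deriv x t)) volume a b := by
  have h1 := (hx a b hab fun t ht => ha.trans ht.1).2
  have h2 : action m x a b < ∞ := by
    rw [h1]
    exact (criticalPotential_le hm _ _ one_pos).trans_lt ENNReal.ofReal_lt_top
  have h3 : ∫⁻ t in Icc a b, ENNReal.ofReal (kinetic m (deriv x t)) < ∞ :=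
    (lintegral_mono fun t => le_self_add).trans_lt h2
  rw [intervalIntegrable_iff_integrableOn_Icc_of_le hab.le]
  refine ⟨(measurable_kinetic_deriv m x).aestronglyMeasurable, ?_⟩
  rw [hasFiniteIntegral_iff_ofReal (Filter.Eventually.of_forall fun t => kinetic_nonneg hm _)]
  exact h3

theorem IsFreeTimeMinimizer.ofReal_integral_eq (hm : ∀ i, 0 < m i) [Nontrivial E]
    (hx : IsFreeTimeMinimizer m x (Ici t₀)) (hΩ : ∀ t, t₀ ≤ t → x t ∈ collisionFree m)
    {a b : ℝ} (ha : t₀ ≤ a) (hab : a < b) :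
    ENNReal.ofReal (∫ t in a..b, kinetic m (deriv x t) + realPotential m (x t)) =
      criticalPotential m (x a) (x b) := by
  rw [← (hx a b hab fun t ht => ha.trans ht.1).2, action, intervalIntegral.integral_of_le hab.le,
    ← integral_Icc_eq_integral_Ioc, ofReal_integral_eq_lintegral_ofReal]
  · refine setLIntegral_congr_fun measurableSet_Icc fun t ht => ?_
    rw [potential_eq_ofReal hm (injective_of_mem_collisionFree hm (hΩ t (ha.trans ht.1))),
      ENNReal.ofReal_add (kinetic_nonneg hm _) (realPotential_nonneg hm _)]
  · exact (intervalIntegrable_iff_integrableOn_Icc_of_le hab.le).1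
      ((hx.intervalIntegrable_kinetic hm ha hab).add
        (hx.intervalIntegrable_realPotential hm hΩ ha hab))
  · exact Filter.Eventually.of_forall fun t =>
      add_nonneg (kinetic_nonneg hm _) (realPotential_nonneg hm _)

/-- Comparison of a free time minimizer with a curve having the same endpoints. -/
theorem IsFreeTimeMinimizer.integral_le (hm : ∀ i, 0 < m i) [Nontrivial E]
    (hx : IsFreeTimeMinimizer m x (Ici t₀)) (hΩ : ∀ t, t₀ ≤ t → x t ∈ collisionFree m)
    {a b : ℝ} (ha : t₀ ≤ a) (hab : a < b) {γ : ℝ → Fin N → E} {c d : ℝ} (hcd : c < d)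
    (hγ : AbsolutelyContinuousOnInterval γ c d) (hc : γ c = x a) (hd : γ d = x b) {h : ℝ → ℝ}
    (hi : IntervalIntegrable h volume c d) (h0 : ∀ᵐ t, t ∈ Ioo c d → 0 ≤ h t)
    (hle : ∀ᵐ t, t ∈ Ioo c d →
      ENNReal.ofReal (kinetic m (deriv γ t)) + potential m (γ t) ≤ ENNReal.ofReal (h t)) :
    ∫ t in a..b, kinetic m (deriv x t) + realPotential m (x t) ≤ ∫ t in c..d, h t := by
  have h1 : criticalPotential m (x a) (x b) ≤ action m γ c d :=
    sInf_le ⟨γ, c, d, hcd, hγ, hc, hd, rfl⟩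
  have h2 := h1.trans (action_le_ofReal hcd.le hi h0 hle)
  rw [← hx.ofReal_integral_eq hm hΩ ha hab] at h2
  refine (ENNReal.ofReal_le_ofReal_iff ?_).1 h2
  rw [intervalIntegral.integral_of_le hcd.le, integral_Ioc_eq_integral_Ioo]
  exact setIntegral_nonneg_of_ae_restrict ((ae_restrict_iff' measurableSet_Ioo).2 h0)

/-- Kinetic and potential energies of a free time minimizer have the same integrals. -/
theorem IsFreeTimeMinimizer.integral_kinetic_eq (hm : ∀ i, 0 < m i) [Nontrivial E]
    (hx : IsFreeTimeMinimizer m x (Ici t₀)) (hΩ : ∀ t, t₀ ≤ t → x t ∈ collisionFree m)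
    {a b : ℝ} (ha : t₀ ≤ a) (hab : a < b) :
    ∫ t in a..b, kinetic m (deriv x t) = ∫ t in a..b, realPotential m (x t) := by
  set A := ∫ t in a..b, kinetic m (deriv x t)
  set B := ∫ t in a..b, realPotential m (x t)
  have hT := hx.intervalIntegrable_kinetic hm ha hab
  have hV := hx.intervalIntegrable_realPotential hm hΩ ha hab
  have hA : 0 ≤ A := intervalIntegral.integral_nonneg hab.le fun t _ => kinetic_nonneg hm _
  have hB : 0 ≤ B := intervalIntegral.integral_nonneg hab.le fun t _ => realPotential_nonneg hm _
  -- The competitor `t ↦ x (c * t)` has action `c A + B / c`; minimality compares it with `A + B`.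
  have key : ∀ c : ℝ, 0 < c → 0 ≤ (c - 1) * (c * A - B) := by
    intro c hc
    have hT' : IntervalIntegrable (fun t => kinetic m (deriv x (c * t))) volume (a / c) (b / c) :=
      hT.comp_mul_left
    have hV' : IntervalIntegrable (fun t => realPotential m (x (c * t))) volume (a / c) (b / c) :=
      hV.comp_mul_left
    have h := hx.integral_le hm hΩ ha hab (γ := fun t => x (c * t))
      (div_lt_div_of_pos_right hab hc)
      (AbsolutelyContinuousOnInterval.comp_const_mul hc (by
        rw [mul_div_cancel₀ _ hc.ne', mul_div_cancel₀ _ hc.ne']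
        exact (hx a b hab fun t ht => ha.trans ht.1).1))
      (by rw [mul_div_cancel₀ _ hc.ne']) (by rw [mul_div_cancel₀ _ hc.ne'])
      (h := fun t => c ^ 2 * kinetic m (deriv x (c * t)) + realPotential m (x (c * t)))
      ((hT'.const_mul _).add hV')
      (Filter.Eventually.of_forall fun t _ => add_nonneg
        (mul_nonneg (sq_nonneg c) (kinetic_nonneg hm _)) (realPotential_nonneg hm _))
      (Filter.Eventually.of_forall fun t ht => by
        have ht' : a < c * t := (div_lt_iff₀' hc).1 ht.1
        rw [deriv_comp_mul_left, kinetic_smul, potential_eq_ofReal hm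
          (injective_of_mem_collisionFree hm (hΩ _ (ha.trans ht'.le))),
          ENNReal.ofReal_add (mul_nonneg (sq_nonneg c) (kinetic_nonneg hm _))
            (realPotential_nonneg hm _)])
    rw [intervalIntegral.integral_add hT hV, intervalIntegral.integral_add (hT'.const_mul _) hV',
      intervalIntegral.integral_const_mul,
      intervalIntegral.integral_comp_mul_left (fun t => kinetic m (deriv x t)) hc.ne',
      intervalIntegral.integral_comp_mul_left (fun t => realPotential m (x t)) hc.ne',
      mul_div_cancel₀ _ hc.ne', mul_div_cancel₀ _ hc.ne', smul_eq_mul, smul_eq_mul] at h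
    change A + B ≤ c ^ 2 * (c⁻¹ * A) + c⁻¹ * B at h
    have h' := mul_le_mul_of_nonneg_left h hc.le
    have e : c * (c ^ 2 * (c⁻¹ * A) + c⁻¹ * B) = c ^ 2 * A + B := by field_simp
    rw [e] at h'
    linarith
  -- If `A ≠ B`, some `c` strictly between `1` and `B / A` contradicts `key`. The choice `2B / (A +
  -- B)` also covers `A = 0`; the other is the midpoint of `1` and `B / A`.
  rcases lt_trichotomy A B with h | h | h
  · have hpos : 0 < A + B := by linarith
    have hBpos : 0 < B := by linarith
    have := key (2 * B / (A + B)) (by positivity)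
    have e : (2 * B / (A + B) - 1) * (2 * B / (A + B) * A - B) =
        -((B - A) ^ 2 * B / (A + B) ^ 2) := by field_simp; ring
    rw [e] at this
    have : 0 < (B - A) ^ 2 * B / (A + B) ^ 2 := by
      have := sub_pos.2 h
      positivity
    linarith
  · exact h
  · have hpos : 0 < A := by linarith
    have := key ((A + B) / (2 * A)) (by positivity)
    have e : ((A + B) / (2 * A) - 1) * ((A + B) / (2 * A) * A - B) =
        -((A - B) ^ 2 / (4 * A)) := by field_simp; ring
    rw [e] at this
    have : 0 < (A - B) ^ 2 / (4 * A) := by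
      have := sub_pos.2 h
      positivity
    linarith

/-- A free time minimizer has zero energy almost everywhere. -/
theorem IsFreeTimeMinimizer.ae_kinetic_eq (hm : ∀ i, 0 < m i) [Nontrivial E]
    (hx : IsFreeTimeMinimizer m x (Ici t₀)) (hΩ : ∀ t, t₀ ≤ t → x t ∈ collisionFree m)
    {a b : ℝ} (ha : t₀ ≤ a) (hab : a < b) :
    ∀ᵐ t, t ∈ Ioo a b → kinetic m (deriv x t) = realPotential m (x t) := by
  have hT := hx.intervalIntegrable_kinetic hm ha hab
  have hV := hx.intervalIntegrable_realPotential hm hΩ ha hab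
  filter_upwards [(hT.sub hV).ae_hasDerivAt_integral] with t h ht
  have h1 := h (by rw [uIcc_of_le hab.le]; exact ⟨ht.1.le, ht.2.le⟩) a left_mem_uIcc
  -- The integral of `T - V` vanishes on every `[a, s]`, so its derivative is zero, while Lebesgue
  -- differentiation gives `T - V` almost everywhere.
  have h2 : HasDerivAt (fun s => ∫ u in a..s,
      (kinetic m (deriv x u) - realPotential m (x u))) 0 t := by
    refine (hasDerivAt_const t (0 : ℝ)).congr_of_eventuallyEq ?_
    filter_upwards [lt_mem_nhds ht.1] with s hs
    rw [intervalIntegral.integral_sub (hx.intervalIntegrable_kinetic hm ha hs)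
      (hx.intervalIntegrable_realPotential hm hΩ ha hs), hx.integral_kinetic_eq hm hΩ ha hs,
      sub_self]
  exact sub_eq_zero.1 (h1.unique h2)

/-- The first variation of the action under homotheties vanishes. -/
theorem IsFreeTimeMinimizer.integral_homothety_eq_zero (hm : ∀ i, 0 < m i) [Nontrivial E]
    (hx : IsFreeTimeMinimizer m x (Ici t₀)) (hΩ : ∀ t, t₀ ≤ t → x t ∈ collisionFree m)
    {a b : ℝ} (ha : t₀ ≤ a) (hab : a < b) {η : ℝ → ℝ}
    (hη : AbsolutelyContinuousOnInterval η a b) (hηa : η a = 0) (hηb : η b = 0)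
    (h1 : ∀ t ∈ Icc a b, |η t| ≤ 1) {D : ℝ} (hD : ∀ t, |deriv η t| ≤ D) :
    ∫ t in a..b, (deriv η t * (1 / 2 * deriv (fun s => inertia m (x s)) t) +
      η t * realPotential m (x t)) = 0 := by
  have hac := (hx a b hab fun t ht => ha.trans ht.1).1
  have hIac := absolutelyContinuousOnInterval_inertia m hac
  have hT := hx.intervalIntegrable_kinetic hm ha hab
  have hV := hx.intervalIntegrable_realPotential hm hΩ ha hab
  set w : ℝ → ℝ := fun t => 1 / 2 * deriv (fun s => inertia m (x s)) t with hw
  have hwi : IntervalIntegrable w volume a b := hIac.intervalIntegrable_deriv.const_mul _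
  have hηw : IntervalIntegrable (fun t => deriv η t * w t) volume a b := by
    refine intervalIntegrable_iff.2 (Integrable.bdd_mul (intervalIntegrable_iff.1 hwi) ?_ (c := D)
      (Filter.Eventually.of_forall hD))
    exact (measurable_deriv η).aestronglyMeasurable
  have hηV : IntervalIntegrable (fun t => η t * realPotential m (x t)) volume a b :=
    hV.continuousOn_mul hη.continuousOn
  have hη2V : IntervalIntegrable (fun t => η t ^ 2 * realPotential m (x t)) volume a b :=
    hV.continuousOn_mul (hη.continuousOn.pow 2)
  have hηηw : IntervalIntegrable (fun t => η t * (deriv η t * w t)) volume a b :=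
    hηw.continuousOn_mul hη.continuousOn
  have hη2T : IntervalIntegrable (fun t => η t ^ 2 * kinetic m (deriv x t)) volume a b :=
    hT.continuousOn_mul (hη.continuousOn.pow 2)
  have hη2I : IntervalIntegrable (fun t => deriv η t ^ 2 * inertia m (x t)) volume a b := by
    refine intervalIntegrable_iff.2 (Integrable.bdd_mul
      (intervalIntegrable_iff.1 hIac.continuousOn.intervalIntegrable) ?_ (c := D ^ 2)
      (Filter.Eventually.of_forall fun t => ?_))
    · exact ((measurable_deriv η).pow_const 2).aestronglyMeasurable
    · rw [norm_pow, Real.norm_eq_abs]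
      exact pow_le_pow_left₀ (abs_nonneg _) (hD t) 2
  -- Coefficient of `ε²` in an upper bound for the Lagrangian of `(1 + εη) x`; the last term comes
  -- from `1 / (1 + u) ≤ 1 - u + 2u²` for `|u| ≤ 1/2`.
  set R : ℝ → ℝ := fun t => 1 / 2 * (deriv η t ^ 2 * inertia m (x t)) +
    η t * (deriv η t * w t) + η t ^ 2 * kinetic m (deriv x t) +
    2 * (η t ^ 2 * realPotential m (x t)) with hR
  have hRi : IntervalIntegrable R volume a b :=
    (((hη2I.const_mul _).add hηηw).add hη2T).add (hη2V.const_mul _)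
  -- The coefficient of `ε` is `η' w + 2ηT - ηV`, which takes this form because `T = V` almost
  -- everywhere.
  set L : ℝ → ℝ := fun t => deriv η t * w t + η t * realPotential m (x t) with hL
  have hLi : IntervalIntegrable L volume a b := hηw.add hηV
  have hTV : IntervalIntegrable (fun t => kinetic m (deriv x t) + realPotential m (x t))
    volume a b := hT.add hV
  have key : ∀ ε : ℝ, |ε| ≤ 1 / 2 → 0 ≤ ε * (∫ t in a..b, L t) + ε ^ 2 * ∫ t in a..b, R t := by
    intro ε hε
    have hεη : ∀ t ∈ Icc a b, |ε * η t| ≤ 1 / 2 := fun t ht => by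
      rw [abs_mul]
      nlinarith [h1 t ht, abs_nonneg (η t), abs_nonneg ε]
    have hbound : ∀ᵐ t, t ∈ Ioo a b →
        ENNReal.ofReal (kinetic m (deriv (fun s => (1 + ε * η s) • x s) t)) +
          potential m ((1 + ε * η t) • x t) ≤
        ENNReal.ofReal (kinetic m (deriv x t) + realPotential m (x t) + ε * L t + ε ^ 2 * R t) ∧
        0 ≤ kinetic m (deriv x t) + realPotential m (x t) + ε * L t + ε ^ 2 * R t := by
      filter_upwards [hη.ae_differentiableAt, hac.ae_differentiableAt_of_finiteDimensional,
        hx.ae_kinetic_eq hm hΩ ha hab] with t ht1 ht2 ht3 ht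
      have htc : t ∈ Icc a b := ⟨ht.1.le, ht.2.le⟩
      have htu : t ∈ uIcc a b := by rwa [uIcc_of_le hab.le]
      have hdη := (ht1 htu).hasDerivAt
      have hdx := (ht2 htu).hasDerivAt
      have hE := ht3 ht
      have hinj := injective_of_mem_collisionFree hm (hΩ t (ha.trans htc.1))
      obtain ⟨hl1, hl2⟩ := abs_le.1 (hεη t htc)
      have hpos : 0 < 1 + ε * η t := by linarith
      have hd : deriv (fun s => (1 + ε * η s) • x s) t =
          (ε * deriv η t) • x t + (1 + ε * η t) • deriv x t := by
        have := ((hdη.const_mul ε).const_add 1).smul hdx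
        rw [add_comm]
        exact this.deriv
      have hwt : w t = massInner m (x t) (deriv x t) := by
        rw [hw]
        simp only
        rw [(hasDerivAt_inertia m hdx).deriv]
        ring
      have hinj' : Function.Injective ((1 + ε * η t) • x t) :=
        (smul_right_injective E hpos.ne').comp hinj
      have hV0 := realPotential_nonneg hm (x t)
      have hdiv : realPotential m (x t) / (1 + ε * η t) ≤
          realPotential m (x t) * (1 - ε * η t + 2 * (ε * η t) ^ 2) := by
        rw [div_le_iff₀ hpos, mul_assoc]
        refine le_mul_of_one_le_right hV0 ?_
        nlinarith [mul_nonneg (sq_nonneg (ε * η t)) (by linarith : 0 ≤ 1 + 2 * (ε * η t))]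
      have hle : kinetic m (deriv (fun s => (1 + ε * η s) • x s) t) +
          realPotential m (x t) / (1 + ε * η t) ≤
          kinetic m (deriv x t) + realPotential m (x t) + ε * L t + ε ^ 2 * R t := by
        rw [hd, kinetic_smul_add_smul, ← hwt]
        refine (add_le_add le_rfl hdiv).trans_eq ?_
        simp only [hL, hR]
        rw [hE]
        ring
      have h0 : 0 ≤ realPotential m (x t) / (1 + ε * η t) := by positivity
      rw [potential_eq_ofReal hm hinj', realPotential_smul m hpos,
        ← ENNReal.ofReal_add (kinetic_nonneg hm _) h0]
      exact ⟨ENNReal.ofReal_le_ofReal hle, (add_nonneg (kinetic_nonneg hm _) h0).trans hle⟩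
    have hc := hx.integral_le hm hΩ ha hab (γ := fun s => (1 + ε * η s) • x s) hab
      (AbsolutelyContinuousOnInterval.fun_smul
        (AbsolutelyContinuousOnInterval.fun_add
          ((LipschitzWith.const (1 : ℝ)).lipschitzOnWith
            (s := uIcc a b)).absolutelyContinuousOnInterval (hη.const_mul ε)) hac)
      (by simp [hηa]) (by simp [hηb])
      (h := fun t => kinetic m (deriv x t) + realPotential m (x t) + ε * L t + ε ^ 2 * R t)
      ((hTV.add (hLi.const_mul _)).add (hRi.const_mul _))
      (hbound.mono fun t h ht => (h ht).2) (hbound.mono fun t h ht => (h ht).1)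
    rw [intervalIntegral.integral_add (hTV.add (hLi.const_mul _)) (hRi.const_mul _),
      intervalIntegral.integral_add hTV (hLi.const_mul _), intervalIntegral.integral_const_mul,
      intervalIntegral.integral_const_mul] at hc
    linarith
  set A := ∫ t in a..b, L t
  set B := ∫ t in a..b, R t
  by_contra hA
  have hA' : 0 < |A| := abs_pos.2 hA
  have hs : 0 < 2 * (|A| + |B|) := by positivity
  -- This `ε` has sign opposite to `A` and is small enough for the linear term to dominate the
  -- quadratic one, contradicting `key`.
  have habs : |-A / (2 * (|A| + |B|))| ≤ 1 / 2 := by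
    rw [abs_div, abs_neg, abs_of_pos hs, div_le_iff₀ hs]
    linarith [abs_nonneg B]
  have h2 := key _ habs
  have e : -A / (2 * (|A| + |B|)) * A + (-A / (2 * (|A| + |B|))) ^ 2 * B =
      A ^ 2 / (2 * (|A| + |B|)) ^ 2 * (B - 2 * (|A| + |B|)) := by field_simp; ring
  rw [e] at h2
  have h3 : 0 < A ^ 2 / (2 * (|A| + |B|)) ^ 2 := by
    rw [← sq_abs A]
    positivity
  have := nonneg_of_mul_nonneg_right h2 h3
  linarith [le_abs_self B, abs_nonneg B]

end NBody

/-! ### From the weak identity to `I'' = 2U`, and Sundman's inequality. -/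

namespace NBody

/-- The piecewise affine function with `tent a = tent b = 0` and `tent c = 1`. -/
noncomputable def tent (a c b t : ℝ) : ℝ := min ((t - a) / (c - a)) ((b - t) / (b - c))

theorem exists_lipschitzWith_tent (a c b : ℝ) : ∃ K, LipschitzWith K (tent a c b) := by
  have h : ∀ p q : ℝ, LipschitzWith ‖p‖₊ fun t : ℝ => p * t + q := fun p q =>
    LipschitzWith.of_dist_le_mul fun s t => by
      rw [Real.dist_eq, Real.dist_eq, add_sub_add_right_eq_sub, ← mul_sub, abs_mul]
      rfl
  have h1 := (h (c - a)⁻¹ (-(a / (c - a)))).min (h (-(b - c)⁻¹) (b / (b - c)))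
  have e : tent a c b = fun t => min ((c - a)⁻¹ * t + -(a / (c - a)))
      (-(b - c)⁻¹ * t + b / (b - c)) := by
    funext t
    rw [tent]
    congr 1 <;> ring
  rw [e]
  exact ⟨_, h1⟩

variable {a b c : ℝ}

theorem tent_eq_left (hac : a < c) (hcb : c < b) {t : ℝ} (ht : t ≤ c) :
    tent a c b t = (t - a) / (c - a) := by
  refine min_eq_left ?_
  have h1 := sub_pos.2 hac
  have h2 := sub_pos.2 hcb
  exact ((div_le_one h1).2 (by linarith)).trans ((one_le_div h2).2 (by linarith))

theorem tent_eq_right (hac : a < c) (hcb : c < b) {t : ℝ} (ht : c ≤ t) :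
    tent a c b t = (b - t) / (b - c) := by
  refine min_eq_right ?_
  have h1 := sub_pos.2 hac
  have h2 := sub_pos.2 hcb
  exact ((div_le_one h2).2 (by linarith)).trans ((one_le_div h1).2 (by linarith))

theorem abs_tent_le_one (hac : a < c) (hcb : c < b) {t : ℝ} (ht : t ∈ Icc a b) :
    |tent a c b t| ≤ 1 := by
  have h1 := sub_pos.2 hac
  have h2 := sub_pos.2 hcb
  have h3 := sub_nonneg.2 ht.1
  have h4 := sub_nonneg.2 ht.2
  rcases le_total t c with h | h
  · rw [tent_eq_left hac hcb h, abs_of_nonneg (by positivity), div_le_one h1]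
    linarith
  · rw [tent_eq_right hac hcb h, abs_of_nonneg (by positivity), div_le_one h2]
    linarith

theorem deriv_tent_left (hac : a < c) (hcb : c < b) {t : ℝ} (ht : t < c) :
    deriv (tent a c b) t = (c - a)⁻¹ := by
  rw [← one_div]
  refine HasDerivAt.deriv ((((hasDerivAt_id t).sub_const a).div_const _).congr_of_eventuallyEq ?_)
  filter_upwards [gt_mem_nhds ht] with u hu using tent_eq_left hac hcb (le_of_lt hu)

theorem deriv_tent_right (hac : a < c) (hcb : c < b) {t : ℝ} (ht : c < t) :
    deriv (tent a c b) t = -(b - c)⁻¹ := by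
  rw [← one_div, ← neg_div]
  refine HasDerivAt.deriv ((((hasDerivAt_id t).const_sub b).div_const _).congr_of_eventuallyEq ?_)
  filter_upwards [lt_mem_nhds ht] with u hu using tent_eq_right hac hcb (le_of_lt hu)

variable {E : Type*} [NormedAddCommGroup E] [InnerProductSpace ℝ E] {N : ℕ}
variable [FiniteDimensional ℝ E] {m : Fin N → ℝ} {x : ℝ → Fin N → E} {t₀ : ℝ}

/-- Weak Lagrange-Jacobi identity, tested against a tent function. -/
theorem IsFreeTimeMinimizer.slope_eq (hm : ∀ i, 0 < m i) [Nontrivial E]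
    (hx : IsFreeTimeMinimizer m x (Ici t₀)) (hΩ : ∀ t, t₀ ≤ t → x t ∈ collisionFree m)
    {V P Q : ℝ → ℝ} (hVc : Continuous V) (hV : ∀ t, t₀ ≤ t → V t = realPotential m (x t))
    (hP : ∀ t, HasDerivAt P (V t) t) (hQ : ∀ t, HasDerivAt Q (P t) t)
    (ha : t₀ ≤ a) (hac : a < c) (hcb : c < b) :
    (c - a)⁻¹ * (1 / 2 * (inertia m (x c) - inertia m (x a)) - (Q c - Q a)) =
      (b - c)⁻¹ * (1 / 2 * (inertia m (x b) - inertia m (x c)) - (Q b - Q c)) := by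
  have hab := hac.trans hcb
  obtain ⟨K, hK⟩ := exists_lipschitzWith_tent a c b
  set η := tent a c b with hη
  have hηac : AbsolutelyContinuousOnInterval η a b :=
    (hK.lipschitzOnWith (s := uIcc a b)).absolutelyContinuousOnInterval
  have hηa : η a = 0 := by rw [hη, tent_eq_left hac hcb hac.le, sub_self, zero_div]
  have hηb : η b = 0 := by rw [hη, tent_eq_right hac hcb hcb.le, sub_self, zero_div]
  have hD : ∀ t, |deriv η t| ≤ K := fun t => norm_deriv_le_of_lipschitz hK
  have hPc : Continuous P := continuous_iff_continuousAt.2 fun t => (hP t).continuousAt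
  have hPac : AbsolutelyContinuousOnInterval P a b := by
    refine (ContDiff.contDiffOn ?_).absolutelyContinuousOnInterval
    rw [contDiff_one_iff_deriv]
    exact ⟨fun t => (hP t).differentiableAt, by rwa [funext fun t => (hP t).deriv]⟩
  have hIac := absolutelyContinuousOnInterval_inertia m (hx a b hab fun t ht => ha.trans ht.1).1
  set w : ℝ → ℝ := fun t => 1 / 2 * deriv (fun s => inertia m (x s)) t with hw
  have hwi : IntervalIntegrable w volume a b := hIac.intervalIntegrable_deriv.const_mul _
  have bdd : ∀ f : ℝ → ℝ, IntervalIntegrable f volume a b →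
      IntervalIntegrable (fun t => deriv η t * f t) volume a b := fun f hf =>
    intervalIntegrable_iff.2 (Integrable.bdd_mul (intervalIntegrable_iff.1 hf)
      (measurable_deriv η).aestronglyMeasurable (c := K) (Filter.Eventually.of_forall hD))
  have hηV : IntervalIntegrable (fun t => η t * realPotential m (x t)) volume a b :=
    (hx.intervalIntegrable_realPotential hm hΩ ha hab).continuousOn_mul hηac.continuousOn
  have hPi : IntervalIntegrable P volume a b := hPc.intervalIntegrable _ _
  have weak := hx.integral_homothety_eq_zero hm hΩ ha hab hηac hηa hηb
    (fun t ht => abs_tent_le_one hac hcb ht) hD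
  have parts := hηac.integral_mul_deriv_eq_deriv_mul hPac
  have hVP : ∫ t in a..b, η t * deriv P t = ∫ t in a..b, η t * realPotential m (x t) := by
    refine intervalIntegral.integral_congr fun t ht => ?_
    rw [uIcc_of_le hab.le] at ht
    simp only [(hP t).deriv, hV t (ha.trans ht.1)]
  rw [hVP, hηa, hηb, zero_mul, zero_mul, sub_zero, zero_sub] at parts
  -- Integration by parts replaces `η V` by `-η' P`. As `η'` is constant on each side of `c`, this
  -- says that `I/2 - Q` has the same slope on `[a, c]` and `[c, b]`.
  have h0 : ∫ t in a..b, deriv η t * (w t - P t) = 0 := by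
    simp only [mul_sub]
    rw [intervalIntegral.integral_sub (bdd w hwi) (bdd P hPi), sub_eq_add_neg, ← parts,
      ← intervalIntegral.integral_add (bdd w hwi) hηV]
    exact weak
  have hsub1 : uIcc a c ⊆ uIcc a b := by
    rw [uIcc_of_le hac.le, uIcc_of_le hab.le]
    exact Icc_subset_Icc_right hcb.le
  have hsub2 : uIcc c b ⊆ uIcc a b := by
    rw [uIcc_of_le hcb.le, uIcc_of_le hab.le]
    exact Icc_subset_Icc_left hac.le
  have hi := bdd _ (hwi.sub hPi)
  have val : ∀ u v : ℝ, uIcc u v ⊆ uIcc a b → ∫ t in u..v, (w t - P t) =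
      1 / 2 * (inertia m (x v) - inertia m (x u)) - (Q v - Q u) := by
    intro u v huv
    rw [intervalIntegral.integral_sub (hwi.mono_set huv) (hPi.mono_set huv),
      intervalIntegral.integral_const_mul, (hIac.mono huv).integral_deriv_eq_sub,
      intervalIntegral.integral_eq_sub_of_hasDerivAt (fun t _ => hQ t) (hPi.mono_set huv)]
  have hne : ∀ᵐ t : ℝ, t ≠ c := by simp [ae_iff, measure_singleton]
  have e1 : ∫ t in a..c, deriv η t * (w t - P t) =
      (c - a)⁻¹ * ∫ t in a..c, (w t - P t) := by
    rw [← intervalIntegral.integral_const_mul]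
    refine intervalIntegral.integral_congr_ae ?_
    filter_upwards [hne] with t ht1 ht2
    rw [uIoc_of_le hac.le] at ht2
    rw [hη, deriv_tent_left hac hcb (lt_of_le_of_ne ht2.2 ht1)]
  have e2 : ∫ t in c..b, deriv η t * (w t - P t) =
      -(b - c)⁻¹ * ∫ t in c..b, (w t - P t) := by
    rw [← intervalIntegral.integral_const_mul]
    refine intervalIntegral.integral_congr_ae (Filter.Eventually.of_forall fun t ht2 => ?_)
    rw [uIoc_of_le hcb.le] at ht2
    rw [hη, deriv_tent_right hac hcb ht2.1]
  rw [← intervalIntegral.integral_add_adjacent_intervals (hi.mono_set hsub1) (hi.mono_set hsub2),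
    e1, e2, val a c hsub1, val c b hsub2] at h0
  linarith

/-- Along a free time minimizer the moment of inertia is twice continuously differentiable, with
second derivative `2 U` (Lagrange-Jacobi identity). -/
theorem IsFreeTimeMinimizer.lagrange_jacobi (hm : ∀ i, 0 < m i) [Nontrivial E]
    (hx : IsFreeTimeMinimizer m x (Ici t₀)) (hΩ : ∀ t, t₀ ≤ t → x t ∈ collisionFree m) :
    ∃ I F V : ℝ → ℝ, Continuous V ∧ (∀ t, HasDerivAt I (2 * F t) t) ∧
      (∀ t, HasDerivAt F (V t) t) ∧ (∀ t, t₀ ≤ t → V t = realPotential m (x t)) ∧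
      ∀ t, t₀ ≤ t → I t = inertia m (x t) := by
  -- Freezing the potential to the left of `t₀` gives primitives differentiable on the whole line,
  -- so one-sided derivatives at `t₀` need no separate treatment.
  set V : ℝ → ℝ := fun t => realPotential m (x (max t t₀)) with hVdef
  have hVc : Continuous V :=
    (hx.continuousOn_realPotential hm hΩ).comp_continuous (f := fun t : ℝ => max t t₀)
      (by fun_prop) fun t => mem_Ici.2 (le_max_right t t₀)
  have hV : ∀ t, t₀ ≤ t → V t = realPotential m (x t) := fun t ht => by
    rw [hVdef]
    simp only [max_eq_left ht]
  set P : ℝ → ℝ := fun t => ∫ s in t₀..t, V s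
  have hP : ∀ t, HasDerivAt P (V t) t := fun t => hVc.integral_hasStrictDerivAt t₀ t |>.hasDerivAt
  have hPc : Continuous P := continuous_iff_continuousAt.2 fun t => (hP t).continuousAt
  set Q : ℝ → ℝ := fun t => ∫ s in t₀..t, P s
  have hQ : ∀ t, HasDerivAt Q (P t) t := fun t => hPc.integral_hasStrictDerivAt t₀ t |>.hasDerivAt
  set J : ℝ → ℝ := fun t => 1 / 2 * inertia m (x t) - Q t with hJ
  set σ := J (t₀ + 1) - J t₀ with hσ
  have slope : ∀ a c b, t₀ ≤ a → a < c → c < b →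
      (c - a)⁻¹ * (J c - J a) = (b - c)⁻¹ * (J b - J c) := by
    intro a c b ha hac hcb
    have := hx.slope_eq hm hΩ hVc hV hP hQ ha hac hcb
    simp only [hJ]
    rw [show 1 / 2 * inertia m (x c) - Q c - (1 / 2 * inertia m (x a) - Q a) =
      1 / 2 * (inertia m (x c) - inertia m (x a)) - (Q c - Q a) by ring, this]
    ring
  -- Equal slopes on adjacent intervals make `J` affine; `t₀ + 1` is just a reference point.
  have hJaff : ∀ t, t₀ ≤ t → J t = J t₀ + σ * (t - t₀) := by
    intro t ht
    rcases ht.eq_or_lt with rfl | ht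
    · simp
    rcases lt_trichotomy t (t₀ + 1) with h | h | h
    · have := slope t₀ t (t₀ + 1) le_rfl ht h
      have h1 := sub_pos.2 ht
      have h2 := sub_pos.2 h
      field_simp at this
      rw [hσ]
      linarith
    · rw [h, hσ]
      ring
    · have := slope t₀ (t₀ + 1) t le_rfl (by linarith) h
      have h1 := sub_pos.2 h
      rw [add_sub_cancel_left, inv_one, one_mul, ← hσ] at this
      field_simp at this
      linarith
  refine ⟨fun t => 2 * (Q t + (J t₀ + σ * (t - t₀))), fun t => P t + σ, V, hVc, fun t => ?_,
    fun t => (hP t).add_const σ, hV, fun t ht => ?_⟩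
  · have h1 : HasDerivAt (fun t => σ * (t - t₀)) (σ * 1) t :=
      ((hasDerivAt_id t).sub_const t₀).const_mul σ
    rw [mul_one] at h1
    exact ((hQ t).add (h1.const_add _)).const_mul 2
  · simp only
    rw [← hJaff t ht, hJ]
    ring

/-- Sundman's inequality along a free time minimizer. -/
theorem IsFreeTimeMinimizer.sundman (hm : ∀ i, 0 < m i) [Nontrivial E]
    (hx : IsFreeTimeMinimizer m x (Ici t₀)) (hΩ : ∀ t, t₀ ≤ t → x t ∈ collisionFree m)
    {I F V : ℝ → ℝ} (hVc : Continuous V) (hI : ∀ t, HasDerivAt I (2 * F t) t)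
    (hF : ∀ t, HasDerivAt F (V t) t) (hV : ∀ t, t₀ ≤ t → V t = realPotential m (x t))
    (hIx : ∀ t, t₀ ≤ t → I t = inertia m (x t)) {t : ℝ} (ht : t₀ < t) :
    F t ^ 2 ≤ 2 * I t * V t := by
  have hae : ∀ᵐ s, s ∈ Ioo t₀ (t + 1) → F s ^ 2 ≤ 2 * I s * V s := by
    have hlt : t₀ < t + 1 := by linarith
    have hac := (hx t₀ (t + 1) hlt Icc_subset_Ici_self).1
    filter_upwards [hac.ae_differentiableAt_of_finiteDimensional,
      hx.ae_kinetic_eq hm hΩ le_rfl hlt] with s h1 h2 hs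
    have hd := (h1 (by rw [uIcc_of_le hlt.le]; exact ⟨hs.1.le, hs.2.le⟩)).hasDerivAt
    have e1 : 2 * F s = 2 * massInner m (x s) (deriv x s) := by
      refine ((hI s).congr_of_eventuallyEq ?_).unique (hasDerivAt_inertia m hd)
      filter_upwards [lt_mem_nhds hs.1] with u hu using (hIx u (le_of_lt hu)).symm
    have e2 : F s = massInner m (x s) (deriv x s) := by linarith
    rw [e2, hIx s hs.1.le, hV s hs.1.le, ← h2 hs]
    exact (massInner_sq_le hm _ _).trans_eq (by ring)
  have hIc : Continuous I := continuous_iff_continuousAt.2 fun t => (hI t).continuousAt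
  have hFc : Continuous F := continuous_iff_continuousAt.2 fun t => (hF t).continuousAt
  -- The inequality is known only almost everywhere; a set of full measure is dense, and continuity
  -- gives every `t`.
  have hcl : IsClosed {s | F s ^ 2 ≤ 2 * I s * V s} := isClosed_le (by fun_prop) (by fun_prop)
  have hmem := (Measure.dense_of_ae hae).open_subset_closure_inter isOpen_Ioo
    (show t ∈ Ioo t₀ (t + 1) from ⟨ht, by linarith⟩)
  refine hcl.closure_subset_iff.2 ?_ hmem
  exact fun s hs => hs.2 hs.1

end NBody

/-! ### Monotonicity and boundedness of `g`, and growth of `I`. -/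

open NBody in
theorem mainTheorem5 {E : Type*} [NormedAddCommGroup E] [InnerProductSpace ℝ E]
    [FiniteDimensional ℝ E] {N : ℕ} (hN : 2 ≤ N) (m : Fin N → ℝ) (hm : ∀ i, 0 < m i)
    (t₀ : ℝ) (x : ℝ → Fin N → E)
    (hx : NBody.IsFreeTimeMinimizer m x (Set.Ici t₀))
    (hΩ : ∀ t, t₀ ≤ t → x t ∈ NBody.collisionFree m) :
    (∀ t, t₀ ≤ t → 0 < NBody.inertia m (x t)) ∧
    DifferentiableOn ℝ (fun t => NBody.inertia m (x t)) (Set.Ici t₀) ∧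
    MonotoneOn (NBody.gFun m x t₀) (Set.Ici t₀) ∧
    (∃ C : ℝ, ∀ t, t₀ ≤ t → |NBody.gFun m x t₀ t| ≤ C) ∧
    (∀ t₁ : ℝ, t₀ ≤ t₁ → 0 < t₁ →
      ∃ β : ℝ, 0 < β ∧ ∀ t, t₁ ≤ t → NBody.inertia m (x t) ≤ β * t ^ (4 / 3 : ℝ)) := by
  have hinj := fun t ht => injective_of_mem_collisionFree hm (hΩ t ht)
  have hE : Nontrivial E := nontrivial_of_injective hN (hinj t₀ le_rfl)
  have hpos : ∀ t, t₀ ≤ t → 0 < inertia m (x t) := fun t ht => inertia_pos hm hN (hinj t ht)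
  obtain ⟨I, F, V, hVc, hI, hF, hV, hIx⟩ := hx.lagrange_jacobi hm hΩ
  have hIpos : ∀ t, t₀ ≤ t → 0 < I t := fun t ht => by rw [hIx t ht]; exact hpos t ht
  have hderiv : ∀ t, t₀ ≤ t →
      HasDerivWithinAt (fun s => inertia m (x s)) (2 * F t) (Ici t₀) t := fun t ht =>
    (hI t).hasDerivWithinAt.congr (fun s hs => (hIx s hs).symm) (hIx t ht).symm
  set g : ℝ → ℝ := fun t => 2 * F t * I t ^ (-(1 / 4) : ℝ) with hg
  have hgFun : ∀ t, t₀ ≤ t → gFun m x t₀ t = g t := fun t ht => by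
    rw [gFun, (hderiv t ht).derivWithin (uniqueDiffOn_Ici t₀ t ht), ← hIx t ht]
  have hgd : ∀ t, t₀ ≤ t → HasDerivAt g
      (2 * V t * I t ^ (-(1 / 4) : ℝ) +
        2 * F t * (2 * F t * (-(1 / 4)) * I t ^ (-(1 / 4) - 1 : ℝ))) t := fun t ht =>
    ((hF t).const_mul 2).mul ((hI t).rpow_const (Or.inl (hIpos t ht).ne'))
  have hmono : MonotoneOn g (Ici t₀) := by
    refine monotoneOn_of_deriv_nonneg (convex_Ici t₀)
      (fun t ht => (hgd t ht).continuousAt.continuousWithinAt)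
      (fun t ht => ?_) (fun t ht => ?_)
    · exact (hgd t (interior_subset ht)).differentiableAt.differentiableWithinAt
    · rw [interior_Ici] at ht
      have hIt := hIpos t (le_of_lt ht)
      have hs := hx.sundman hm hΩ hVc hI hF hV hIx ht
      rw [(hgd t (le_of_lt ht)).deriv]
      have e : I t ^ (-(1 / 4) : ℝ) = I t ^ (-(1 / 4) - 1 : ℝ) * I t := by
        rw [← Real.rpow_add_one hIt.ne']
        norm_num
      rw [e]
      -- This product is exactly `g'(t)`.
      have : 0 ≤ I t ^ (-(1 / 4) - 1 : ℝ) * (2 * I t * V t - F t ^ 2) :=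
        mul_nonneg (by positivity) (sub_nonneg.2 hs)
      linarith
  have hFmono : MonotoneOn F (Ici t₀) := by
    refine monotoneOn_of_deriv_nonneg (convex_Ici t₀)
      (fun t _ => (hF t).continuousAt.continuousWithinAt)
      (fun t _ => (hF t).differentiableAt.differentiableWithinAt) (fun t ht => ?_)
    rw [(hF t).deriv, hV t (interior_subset ht)]
    exact realPotential_nonneg hm _
  have hIc : Continuous I := continuous_iff_continuousAt.2 fun t => (hI t).continuousAt
  have hFbound : ∀ t, t₀ < t → 2 * F t ≤ 2 * F t₀ +
      (2 + 12 * actionConst m) * (1 + I t₀ + I t) ^ (1 / 4 : ℝ) := by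
    intro t ht
    have hI0 := hIpos t₀ le_rfl
    have hIt := hIpos t ht.le
    have hT := hx.intervalIntegrable_kinetic hm le_rfl ht
    have hV' := hx.intervalIntegrable_realPotential hm hΩ le_rfl ht
    have hact : ∫ s in t₀..t, kinetic m (deriv x s) + realPotential m (x s) =
        2 * (F t - F t₀) := by
      have hFi : ∫ s in t₀..t, realPotential m (x s) = F t - F t₀ := by
        rw [← intervalIntegral.integral_eq_sub_of_hasDerivAt (fun s _ => hF s)
          (hVc.intervalIntegrable _ _)]
        refine intervalIntegral.integral_congr fun s hs => ?_
        rw [uIcc_of_le ht.le] at hs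
        exact (hV s hs.1).symm
      rw [intervalIntegral.integral_add hT hV', hx.integral_kinetic_eq hm hΩ le_rfl ht, hFi]
      ring
    -- With `S = R^(3/4)` both terms of `criticalPotential_le` are of order `R^(1/4)`. The summand
    -- `1` makes `R ≥ 1`, so that the constant `2 F t₀` can later be absorbed.
    set R := 1 + I t₀ + I t with hR
    have hRpos : 0 < R := by positivity
    have hS : 0 < R ^ (3 / 4 : ℝ) := by positivity
    have hφ := criticalPotential_le hm (x t₀) (x t) hS
    rw [← hx.ofReal_integral_eq hm hΩ le_rfl ht, hact, ← hIx t₀ le_rfl, ← hIx t ht.le,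
      ← Real.rpow_mul hRpos.le] at hφ
    have hC := actionConst_nonneg hm
    have hle := (ENNReal.ofReal_le_ofReal_iff (by positivity)).1 hφ
    have e : R / R ^ (3 / 4 : ℝ) = R ^ (1 / 4 : ℝ) := by
      rw [div_eq_iff hS.ne', ← Real.rpow_add hRpos]
      norm_num
    have h1 : 2 * (I t₀ + I t) / R ^ (3 / 4 : ℝ) ≤ 2 * R ^ (1 / 4 : ℝ) := by
      rw [← e, ← mul_div_assoc]
      gcongr
      linarith
    rw [show (3 / 4 * (1 / 3) : ℝ) = 1 / 4 by norm_num] at hle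
    linarith
  have hupper : ∃ C : ℝ, ∀ t, t₀ ≤ t → g t ≤ C := by
    by_cases hcase : ∃ t₁, t₀ ≤ t₁ ∧ 0 < F t₁
    · obtain ⟨t₁, ht₁, hF1⟩ := hcase
      have hI1 := hIpos t₁ ht₁
      have hImono : MonotoneOn I (Ici t₁) := by
        refine monotoneOn_of_deriv_nonneg (convex_Ici t₁) hIc.continuousOn
          (fun t _ => (hI t).differentiableAt.differentiableWithinAt) (fun t ht => ?_)
        rw [(hI t).deriv]
        have ht' : t₁ ≤ t := interior_subset ht
        have := hFmono ht₁ (ht₁.trans ht') ht'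
        linarith
      set A := |2 * F t₀| + (2 + 12 * actionConst m) with hA
      have hC := actionConst_nonneg hm
      refine ⟨A * ((1 + I t₀) / I t₁ + 1) ^ (1 / 4 : ℝ), fun t ht => ?_⟩
      have hlate : ∀ s, t₁ < s → g s ≤ A * ((1 + I t₀) / I t₁ + 1) ^ (1 / 4 : ℝ) := by
        intro s hs
        have hs0 := ht₁.trans hs.le
        have hIs := hIpos s hs0
        have hI0 := hIpos t₀ le_rfl
        have hle : I t₁ ≤ I s := hImono self_mem_Ici hs.le hs.le
        have h1 := hFbound s (ht₁.trans_lt hs)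
        have hR1 : 1 ≤ (1 + I t₀ + I s) ^ (1 / 4 : ℝ) :=
          Real.one_le_rpow (by linarith) (by norm_num)
        have h2 : 2 * F s ≤ A * (1 + I t₀ + I s) ^ (1 / 4 : ℝ) := by
          rw [hA]
          nlinarith [le_abs_self (2 * F t₀), abs_nonneg (2 * F t₀)]
        have h3 : g s ≤ A * ((1 + I t₀ + I s) / I s) ^ (1 / 4 : ℝ) := by
          rw [hg]
          simp only
          rw [Real.div_rpow (by positivity) hIs.le, ← mul_div_assoc, Real.rpow_neg hIs.le,
            ← div_eq_mul_inv]
          gcongr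
        refine h3.trans ?_
        rw [add_div, div_self hIs.ne']
        gcongr
      -- Monotonicity of `g` carries the bound from times after `t₁` back to an arbitrary `t`.
      exact (hmono ht (ht₁.trans ((le_max_right t t₁).trans (by linarith)) )
        ((le_max_left t t₁).trans (by linarith : max t t₁ ≤ max t t₁ + 1))).trans
        (hlate (max t t₁ + 1) (by linarith [le_max_right t t₁]))
    · push Not at hcase
      refine ⟨0, fun t ht => ?_⟩
      have := hcase t ht
      have := hIpos t ht
      exact mul_nonpos_of_nonpos_of_nonneg (by linarith) (by positivity)
  obtain ⟨C, hC⟩ := hupper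
  refine ⟨hpos, fun t ht => (hderiv t ht).differentiableWithinAt, ?_, ?_, ?_⟩
  · intro s hs t ht hst
    rw [hgFun s hs, hgFun t ht]
    exact hmono hs ht hst
  · refine ⟨max |g t₀| |C|, fun t ht => ?_⟩
    rw [hgFun t ht]
    exact abs_le_max_abs_abs (hmono self_mem_Ici ht ht) (hC t ht)
  · intro t₁ ht₁ ht₁pos
    have hH : ∀ t, t₀ ≤ t → HasDerivAt (fun s => I s ^ (3 / 4 : ℝ)) (3 / 4 * g t) t := by
      intro t ht
      have := (hI t).rpow_const (p := 3 / 4) (Or.inl (hIpos t ht).ne')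
      convert! this using 1
      rw [hg]
      norm_num
      ring
    have hC' : ∀ t, t₀ ≤ t → 3 / 4 * g t ≤ |C| := fun t ht => by
      have := hC t ht
      linarith [le_abs_self C, abs_nonneg C]
    have hgrow : ∀ t, t₁ ≤ t → I t ^ (3 / 4 : ℝ) ≤ I t₁ ^ (3 / 4 : ℝ) + |C| * (t - t₁) := by
      intro t ht
      have := (convex_Ici t₁).image_sub_le_mul_sub_of_deriv_le
        (f := fun s => I s ^ (3 / 4 : ℝ)) (C := |C|)
        (fun s hs => (hH s (ht₁.trans hs)).continuousAt.continuousWithinAt)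
        (fun s hs => (hH s (ht₁.trans
          (interior_subset hs))).differentiableAt.differentiableWithinAt)
        (fun s hs => by
          have hs' := ht₁.trans (interior_subset hs)
          rw [(hH s hs').deriv]
          exact hC' s hs') t₁ self_mem_Ici t ht ht
      linarith
    have hI1 := hIpos t₁ ht₁
    -- Since `t ≥ t₁ > 0`, the initial value `I t₁ ^ (3/4)` is at most its quotient by `t₁` times
    -- `t`, which makes the affine bound linear.
    set B := I t₁ ^ (3 / 4 : ℝ) / t₁ + |C| with hB
    have hBpos : 0 < B := by positivity
    refine ⟨B ^ (4 / 3 : ℝ), by positivity, fun t ht => ?_⟩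
    have htpos := ht₁pos.trans_le ht
    have hIt := hIpos t (ht₁.trans ht)
    have h1 : I t ^ (3 / 4 : ℝ) ≤ B * t := by
      refine (hgrow t ht).trans ?_
      have h2 : I t₁ ^ (3 / 4 : ℝ) ≤ I t₁ ^ (3 / 4 : ℝ) / t₁ * t := by
        rw [div_mul_eq_mul_div, le_div_iff₀ ht₁pos]
        gcongr
      rw [hB, add_mul]
      refine add_le_add h2 ?_
      gcongr
      linarith
    rw [← hIx t (ht₁.trans ht), ← Real.mul_rpow hBpos.le htpos.le]
    calc I t = (I t ^ (3 / 4 : ℝ)) ^ (4 / 3 : ℝ) := by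
          rw [← Real.rpow_mul hIt.le]
          norm_num
      _ ≤ (B * t) ^ (4 / 3 : ℝ) := by gcongr
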